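/- Let $n\ge 2$ and let $(M^{2n},\omega)$ be an almost symplectic manifold, i.e. a smooth manifold of dimension $2n$ with a smooth non-degenerate (not necessarily closed) $2$-form $\omega$. Let $\flat_\omega X=i(X)\omega=\omega(X,\cdot)$, let $\sharp_\omega=\flat_\omega^{-1}$, extended to forms of higher degree by $\sharp_\omega(\alpha_1\wedge\dots\wedge\alpha_k)=\sharp_\omega\alpha_1\wedge\dots\wedge\sharp_\omega\alpha_k$, and let $i(X_1\wedge\dots\wedge X_k)\mu=\mu(X_1,\dots,X_k,\cdot)$. Put $$\Lambda=i(\omega^{-1}),\qquad \star\nu=\frac{1}{n!}\,i(\sharp_\omega\nu)\,\omega^n,\qquad \delta=\star d\star ,$$ where $\omega^{-1}$ is the inverse bivector of $\omega$, $\omega^{-1}(\alpha,\beta)=\omega(\sharp_\omega\alpha,\sharp_\omega\beta)$; a form $\nu$ is called primitive if $\Lambda\nu=0$. A smooth vector field $X$ is called locally Hamiltonian if $d(i(X)\omega)=0$ and $L_X\omega=0$. A function $f\in C^\infty(M)$ is called Hamiltonian if there is a smooth vector field $X$ with $L_X\omega=0$ and $i(X)\omega=-df$. Then $$d\omega=\sigma\wedge\omega+\psi,\qquad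 \sigma=\frac{1}{n-1}\,\delta\omega ,$$ where $\sigma$ and $\psi$ are smooth, $\psi$ is primitive, and $\psi=0$ if $n=2$. A smooth vector field $X$ is locally Hamiltonian if and only if $$\sigma(X)=0,\qquad \sigma\wedge(i(X)\omega)-i(X)\psi=0,\qquad d(i(X)\omega)=0 .$$ A function $f\in C^\infty(M)$ is Hamiltonian if and only if $$(\sharp_\omega\sigma)f=0,\qquad \sigma\wedge df-i(\sharp_\omega df)\psi=0 .$$ -/

import Mathlib

open scoped Manifold ContDiff

noncomputable section

/-! ### Exterior algebra of a finite-dimensional real vector space -/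

namespace AlmostSymplectic

section Algebra

variable {V : Type*} [NormedAddCommGroup V] [NormedSpace ℝ V]

/-- The tensor product of alternating forms:
`(v₁, …, v_{k+l}) ↦ α (v₁, …, v_k) * β (v_{k+1}, …, v_{k+l})`. -/
def tensor {k l : ℕ} (α : V [⋀^Fin k]→L[ℝ] ℝ) (β : V [⋀^Fin l]→L[ℝ] ℝ) :
    ContinuousMultilinearMap ℝ (fun _ : Fin (k + l) => V) ℝ where
  toMultilinearMap := ((LinearMap.mul' ℝ ℝ).compMultilinearMap
    (MultilinearMap.domCoprod (α.toAlternatingMap : MultilinearMap ℝ (fun _ => V) ℝ)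
      (β.toAlternatingMap : MultilinearMap ℝ (fun _ => V) ℝ))).domDomCongr finSumFinEquiv
  cont := by
    change Continuous fun v : Fin (k + l) → V =>
      α (fun i => v (Fin.castAdd l i)) * β (fun i => v (Fin.natAdd k i))
    exact (α.cont.comp (by fun_prop)).mul (β.cont.comp (by fun_prop))

/-- The exterior product `α ∧ β = (1 / (k! l!)) ∑_s sign s • (α ⊗ β) ∘ s`, so that
`(α ∧ β) (v, w) = α v * β w - α w * β v` for `1`-forms. -/
def wedge {k l : ℕ} (α : V [⋀^Fin k]→L[ℝ] ℝ) (β : V [⋀^Fin l]→L[ℝ] ℝ) :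
    V [⋀^Fin (k + l)]→L[ℝ] ℝ :=
  (((k.factorial : ℝ) * (l.factorial : ℝ))⁻¹) •
    ContinuousMultilinearMap.alternatization (tensor α β)

/-- The exterior power `Ω ^ m = Ω ∧ … ∧ Ω` of a `2`-form. -/
def wedgePow (Ω : V [⋀^Fin 2]→L[ℝ] ℝ) : (m : ℕ) → V [⋀^Fin (2 * m)]→L[ℝ] ℝ
  | 0 => ContinuousAlternatingMap.constOfIsEmpty ℝ V (Fin 0) 1
  | m + 1 => wedge (wedgePow Ω m) Ω

/-- An alternating form of degree `k`, regarded as one of degree `l = k`. -/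
def castDegree {k l : ℕ} (h : k = l) (μ : V [⋀^Fin k]→L[ℝ] ℝ) : V [⋀^Fin l]→L[ℝ] ℝ where
  toContinuousMultilinearMap := μ.toContinuousMultilinearMap.domDomCongr (finCongr h)
  map_eq_zero_of_eq' := (μ.toAlternatingMap.domDomCongr (finCongr h)).map_eq_zero_of_eq'

/-- A covector as a form of degree `1`. -/
def oneForm (φ : V →L[ℝ] ℝ) : V [⋀^Fin 1]→L[ℝ] ℝ :=
  ContinuousAlternatingMap.ofSubsingleton ℝ V ℝ (0 : Fin 1) φ

/-- A form of degree `1` as a covector. -/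
def covector (α : V [⋀^Fin 1]→L[ℝ] ℝ) : Module.Dual ℝ V :=
  ((ContinuousAlternatingMap.ofSubsingleton ℝ V ℝ (0 : Fin 1)).symm α : V →L[ℝ] ℝ)

/-- The contraction `i(v)ν = ν (v, ·)`. -/
def interior {k : ℕ} (v : V) (ν : V [⋀^Fin (k + 1)]→L[ℝ] ℝ) : V [⋀^Fin k]→L[ℝ] ℝ :=
  ν.curryLeft v

/-- The contraction `i(v₁ ∧ … ∧ v_k)μ = μ (v₁, …, v_k, ·)` by a decomposable multivector. -/
def interiorVectors {l : ℕ} : (k : ℕ) → (Fin k → V) → V [⋀^Fin (l + k)]→L[ℝ] ℝ →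
    V [⋀^Fin l]→L[ℝ] ℝ
  | 0, _, μ => μ
  | k + 1, v, μ => interiorVectors k (fun i => v i.succ) (interior (k := l + k) (v 0) μ)

/-- `k`-vectors, as alternating `k`-linear functions on the dual space; `v₁ ∧ … ∧ v_k` is the
function `(φ₁, …, φ_k) ↦ det (φ_i (v_j))`. -/
abbrev Multivector (V : Type*) [NormedAddCommGroup V] [NormedSpace ℝ V] (k : ℕ) : Type _ :=
  (Module.Dual ℝ V) [⋀^Fin k]→ₗ[ℝ] ℝ

/-- The contraction `i(P)μ` of a form by a `k`-vector `P`: if `P` has the components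
`P^{j₁…j_k}` in a basis `b` then
`i(P)μ = (1 / k!) ∑ P^{j₁…j_k} μ (b_{j₁}, …, b_{j_k}, ·)`. -/
def contract [FiniteDimensional ℝ V] {k l : ℕ} (P : Multivector V k)
    (μ : V [⋀^Fin (l + k)]→L[ℝ] ℝ) : V [⋀^Fin l]→L[ℝ] ℝ :=
  ((k.factorial : ℝ)⁻¹) • ∑ j : Fin k → Fin (Module.finrank ℝ V),
    P (fun a => (Module.finBasis ℝ V).coord (j a)) •
      interiorVectors k (fun a => Module.finBasis ℝ V (j a)) μ

/-- Non-degeneracy of a `2`-form: `i(v)Ω = 0` only for `v = 0`. -/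
def Nondegenerate (Ω : V [⋀^Fin 2]→L[ℝ] ℝ) : Prop :=
  ∀ v : V, interior v Ω = 0 → v = 0

/-- The linear map `♭_Ω v = i(v)Ω`. -/
def flat (Ω : V [⋀^Fin 2]→L[ℝ] ℝ) : V →ₗ[ℝ] Module.Dual ℝ V where
  toFun v := covector (interior v Ω)
  map_add' v w := by
    ext u
    simp [covector, interior]
  map_smul' c v := by
    ext u
    simp [covector, interior]

theorem flat_injective {Ω : V [⋀^Fin 2]→L[ℝ] ℝ} (h : Nondegenerate Ω) :
    Function.Injective (flat Ω) := by
  rw [← LinearMap.ker_eq_bot, LinearMap.ker_eq_bot']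
  intro v hv
  refine h v ?_
  have h1 : (ContinuousAlternatingMap.ofSubsingleton ℝ V ℝ (0 : Fin 1)).symm (interior v Ω)
      = 0 := by
    ext u
    exact congrArg (fun φ : Module.Dual ℝ V => φ u) hv
  rw [Equiv.symm_apply_eq] at h1
  rw [h1]
  rfl

variable [FiniteDimensional ℝ V]

/-- The musical isomorphism `♯_Ω = ♭_Ω⁻¹` from covectors to vectors. -/
def sharp (Ω : V [⋀^Fin 2]→L[ℝ] ℝ) (h : Nondegenerate Ω) : Module.Dual ℝ V ≃ₗ[ℝ] V :=
  ((flat Ω).linearEquivOfInjective (flat_injective h) Subspace.dual_finrank_eq.symm).symm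

/-- The transpose of `♯_Ω`, as a map from `V^*` to `V^** = V`. -/
def sharpTranspose (Ω : V [⋀^Fin 2]→L[ℝ] ℝ) (h : Nondegenerate Ω) : Module.Dual ℝ V →ₗ[ℝ] V :=
  (Module.evalEquiv ℝ V).symm.toLinearMap ∘ₗ (sharp Ω h).toLinearMap.dualMap

/-- The multivector `♯_Ω ν` of a `k`-form `ν`, that is, the image of `ν` under the map
`⋀^k V^* → ⋀^k V` induced by `♯_Ω`, with `♯_Ω (φ₁ ∧ … ∧ φ_k) = ♯_Ω φ₁ ∧ … ∧ ♯_Ω φ_k`. -/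
def sharpForm (Ω : V [⋀^Fin 2]→L[ℝ] ℝ) (h : Nondegenerate Ω) {k : ℕ}
    (ν : V [⋀^Fin k]→L[ℝ] ℝ) : Multivector V k :=
  ν.toAlternatingMap.compLinearMap (sharpTranspose Ω h)

/-- The inverse bivector `Ω⁻¹`, that is, `Ω` carried over to `V^*` by `♯_Ω`:
`Ω⁻¹ (φ, χ) = Ω (♯_Ω φ, ♯_Ω χ)`. -/
def inverseBivector (Ω : V [⋀^Fin 2]→L[ℝ] ℝ) (h : Nondegenerate Ω) : Multivector V 2 :=
  Ω.toAlternatingMap.compLinearMap (sharp Ω h).toLinearMap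

/-- The operator `Λ = i(Ω⁻¹)`. -/
def lefschetzDual (Ω : V [⋀^Fin 2]→L[ℝ] ℝ) (h : Nondegenerate Ω) {l : ℕ}
    (ν : V [⋀^Fin (l + 2)]→L[ℝ] ℝ) : V [⋀^Fin l]→L[ℝ] ℝ :=
  contract (inverseBivector Ω h) ν

/-- The symplectic star operator `⋆ν = i(♯_Ω ν) (Ω^n / n!)` from `k`-forms to `l`-forms on a
space of dimension `2 * n = l + k`. -/
def star (Ω : V [⋀^Fin 2]→L[ℝ] ℝ) (h : Nondegenerate Ω) {n k l : ℕ} (hkl : 2 * n = l + k)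
    (ν : V [⋀^Fin k]→L[ℝ] ℝ) : V [⋀^Fin l]→L[ℝ] ℝ :=
  contract (sharpForm Ω h ν)
    (((n.factorial : ℝ)⁻¹) • castDegree hkl (wedgePow Ω n))

end Algebra

/-! ### Differential forms on a manifold -/

section Manifold

variable (E : Type*) [NormedAddCommGroup E] [NormedSpace ℝ E]
variable (M : Type*) [TopologicalSpace M] [ChartedSpace E M]

/-- Differential `k`-forms on `M` (not necessarily smooth). -/
abbrev DForm (k : ℕ) : Type _ :=
  ∀ x : M, (TangentSpace 𝓘(ℝ, E) x) [⋀^Fin k]→L[ℝ] ℝ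

/-- Vector fields on `M` (not necessarily smooth). -/
abbrev VField : Type _ := ∀ x : M, TangentSpace 𝓘(ℝ, E) x

variable {E M}

/-- The expression of a form in the preferred chart at `x₀`. -/
def DForm.inChart {k : ℕ} (ν : DForm E M k) (x₀ : M) : E → E [⋀^Fin k]→L[ℝ] ℝ := fun y =>
  (ν ((extChartAt 𝓘(ℝ, E) x₀).symm y)).compContinuousLinearMap
    (mfderiv 𝓘(ℝ, E) 𝓘(ℝ, E) (extChartAt 𝓘(ℝ, E) x₀).symm y)

/-- The form with given expression in the preferred chart at `x₀`, evaluated at `x₀`. -/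
def ofChart {k : ℕ} (x₀ : M) (η : E → E [⋀^Fin k]→L[ℝ] ℝ) :
    (TangentSpace 𝓘(ℝ, E) x₀) [⋀^Fin k]→L[ℝ] ℝ :=
  (η (extChartAt 𝓘(ℝ, E) x₀ x₀)).compContinuousLinearMap
    (mfderiv 𝓘(ℝ, E) 𝓘(ℝ, E) (extChartAt 𝓘(ℝ, E) x₀) x₀)

/-- The expression of a vector field in the preferred chart at `x₀`. -/
def VField.inChart (X : VField E M) (x₀ : M) : E → E := fun y =>
  mfderiv 𝓘(ℝ, E) 𝓘(ℝ, E) (extChartAt 𝓘(ℝ, E) x₀) ((extChartAt 𝓘(ℝ, E) x₀).symm y)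
    (X ((extChartAt 𝓘(ℝ, E) x₀).symm y))

/-- A form is smooth if its coefficients in the charts are. -/
def DForm.IsSmooth {k : ℕ} (ν : DForm E M k) : Prop :=
  ∀ x₀ : M, ContDiffOn ℝ ∞ (ν.inChart x₀) (extChartAt 𝓘(ℝ, E) x₀).target

/-- A vector field is smooth if it is a smooth section of the tangent bundle. -/
def VField.IsSmooth [IsManifold 𝓘(ℝ, E) ∞ M] (X : VField E M) : Prop :=
  ContMDiff 𝓘(ℝ, E) 𝓘(ℝ, E).tangent ∞
    (fun x : M => (⟨x, X x⟩ : TangentBundle 𝓘(ℝ, E) M))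

/-- The exterior derivative of a differential form, computed in charts. -/
def DForm.d {k : ℕ} (ν : DForm E M k) : DForm E M (k + 1) := fun x =>
  ofChart x (extDeriv (ν.inChart x))

/-- The Lie derivative of a form on a vector space, given by
`(L_X η)(v₁, …, v_k) = (D_X η)(v₁, …, v_k) + ∑ i, η (v₁, …, D_{v_i} X, …, v_k)`. -/
def lieDerivVectorSpace {k : ℕ} (X : E → E) (η : E → E [⋀^Fin k]→L[ℝ] ℝ) :
    E → E [⋀^Fin k]→L[ℝ] ℝ := fun y =>
  fderiv ℝ η y (X y) +
    (η y).fderivCompContinuousLinearMap (ContinuousLinearMap.id ℝ E) (fderiv ℝ X y)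

/-- The Lie derivative `L_X ν` of a differential form, computed in charts. -/
def DForm.lieDeriv {k : ℕ} (X : VField E M) (ν : DForm E M k) : DForm E M k := fun x =>
  ofChart x (lieDerivVectorSpace (X.inChart x) (ν.inChart x))

/-- The exterior product of differential forms. -/
def DForm.wedge {k l : ℕ} (α : DForm E M k) (β : DForm E M l) : DForm E M (k + l) := fun x =>
  AlmostSymplectic.wedge (V := E) (α x) (β x)

/-- The contraction `i(X)ν` of a differential form by a vector field. -/
def DForm.interior {k : ℕ} (X : VField E M) (ν : DForm E M (k + 1)) : DForm E M k := fun x =>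
  AlmostSymplectic.interior (V := E) (X x) (ν x)

/-- The differential `df` of a function, as a `1`-form. -/
def differential (f : M → ℝ) : DForm E M 1 := fun x =>
  oneForm (V := E) (mfderiv 𝓘(ℝ, E) 𝓘(ℝ, ℝ) f x)

variable (E M) in
/-- An almost symplectic form: a smooth, non-degenerate (not necessarily closed) `2`-form. -/
structure Form where
  /-- The underlying differential form. -/
  toDForm : DForm E M 2
  isSmooth : toDForm.IsSmooth
  nondegenerate : ∀ x : M, Nondegenerate (V := E) (toDForm x)

namespace Form

variable [FiniteDimensional ℝ E] (Ω : Form E M)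

/-- The vector field `♯_Ω α` of a `1`-form. -/
def sharp (α : DForm E M 1) : VField E M := fun x =>
  AlmostSymplectic.sharp (V := E) (Ω.toDForm x) (Ω.nondegenerate x) (covector (V := E) (α x))

/-- The operator `Λ = i(Ω⁻¹)` on differential forms. -/
def lefschetzDual {l : ℕ} (ν : DForm E M (l + 2)) : DForm E M l := fun x =>
  AlmostSymplectic.lefschetzDual (V := E) (Ω.toDForm x) (Ω.nondegenerate x) (ν x)

/-- The forms `ν` with `Λν = 0`, in degree at least `2`. -/
def IsPrimitive {l : ℕ} (ν : DForm E M (l + 2)) : Prop :=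
  Ω.lefschetzDual ν = 0

/-- The operator `⋆` from `k`-forms to `l`-forms, where `2 * n = l + k` is the dimension. -/
def star {n k l : ℕ} (hkl : 2 * n = l + k) (ν : DForm E M k) : DForm E M l := fun x =>
  AlmostSymplectic.star (V := E) (Ω.toDForm x) (Ω.nondegenerate x) hkl (ν x)

/-- The operator `δ = ⋆ d ⋆` from `(k + 1)`-forms to `k`-forms; here `l = 2 * n - (k + 1)`, where
`2 * n` is the dimension. -/
def codifferential {n k l : ℕ} (hkl : 2 * n = l + (k + 1)) (ν : DForm E M (k + 1)) :
    DForm E M k :=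
  Ω.star (n := n) (k := l + 1) (by omega) (Ω.star hkl ν).d

/-- The `1`-form `σ = δΩ / (n - 1)`, in dimension `2 * n ≥ 4`. -/
def lee {n : ℕ} (hn : 2 ≤ n) : DForm E M 1 :=
  (((n : ℝ) - 1)⁻¹) • Ω.codifferential (n := n) (k := 1) (l := 2 * n - 2) (by omega) Ω.toDForm


variable [IsManifold 𝓘(ℝ, E) ∞ M]

/-- The Hamiltonian vector fields with Hamiltonian function `f`: smooth, `L_X Ω = 0` and
`i(X)Ω = -df`. -/
def IsHamiltonianFieldOf (X : VField E M) (f : M → ℝ) : Prop :=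
  X.IsSmooth ∧ Ω.toDForm.lieDeriv X = 0 ∧ Ω.toDForm.interior X = -differential f

/-- The functions that have a Hamiltonian vector field. -/
def IsHamiltonianFunction (f : M → ℝ) : Prop :=
  ∃ X : VField E M, Ω.IsHamiltonianFieldOf X f

/-- The locally Hamiltonian vector fields: smooth, `d(i(X)Ω) = 0` and `L_X Ω = 0`. -/
def IsLocallyHamiltonian (X : VField E M) : Prop :=
  X.IsSmooth ∧ (Ω.toDForm.interior X).d = 0 ∧ Ω.toDForm.lieDeriv X = 0

end Form

end Manifold

end AlmostSymplectic

end

/-! At each point, write `L` for exterior multiplication by `Ω` and `Λ = i(Ω⁻¹)`. On `k`-forms of a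
space of dimension `2n` they satisfy `ΛL - LΛ = n - k` (`dualLefschetz_lefschetz`), which follows
from the anticommutation relations of contractions and exterior multiplications. In degree 1 this
gives `Λ(α ∧ Ω) = (n - 1)α`, so `dΩ - σ ∧ Ω` is primitive exactly for `σ = ΛdΩ / (n - 1)`. If `n =
2`, a primitive 3-form `ψ` has `-ψ = ΛLψ - LΛψ = 0`, because 5-forms vanish in dimension 4.

That this `σ` is `δΩ / (n - 1)` means `δΩ = ΛdΩ` (`codifferential_self`). Indeed `⋆Ω = Ω^(n-1) /
(n-1)!`, whose differential is `Ω^(n-2) ∧ dΩ / (n-2)!`, and `⋆(L^(n-2) γ) = (n-2)! Λγ` for 3-forms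
`γ` (`star_lefschetz_pow`). The last identity holds since contraction by `♯(Ω ∧ F)` is `Λ` followed
by contraction by `♯F` (`contractOp_lefschetz`).

By Cartan's formula (`lieDeriv_eq`), once `i(X)Ω` is closed, `L_X Ω = 0` means `i(X)dΩ = 0`, that
is, `σ(X)Ω = σ ∧ i(X)Ω - i(X)ψ`. Applying `Λ`, which commutes with `i(X)` and kills `ψ`, leaves `(n
- 1)σ(X) = 0`. So both sides vanish separately (`interior_eq_zero_iff`). For a function `f` the only
candidate field is `-♯df`; it is smooth and `i(X)Ω = -df` is closed, so the same criterion applies.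

The algebra is done on families with one form in each degree, so that `L`, `Λ` and the contractions
are endomorphisms of a single space and identities between degrees need no transport. The analysis
consists of naturality under charts, independence of `d` from the chart, and smoothness of matrix
inversion. -/

noncomputable section

namespace AlmostSymplectic

/-! ### Contraction and exterior multiplication by a covector. -/

section Operators

variable {V : Type*} [NormedAddCommGroup V] [NormedSpace ℝ V]

theorem interior_apply {k : ℕ} (v : V) (ν : V [⋀^Fin (k + 1)]→L[ℝ] ℝ) (w : Fin k → V) :
    interior v ν w = ν (Matrix.vecCons v w) := rfl

theorem flat_apply (Ω : V [⋀^Fin 2]→L[ℝ] ℝ) (v w : V) : flat Ω v w = Ω ![v, w] := by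
  change interior v Ω (fun _ => w) = _
  rw [interior_apply]
  congr 1
  ext i
  fin_cases i <;> rfl

theorem flat_antisymm (Ω : V [⋀^Fin 2]→L[ℝ] ℝ) (v w : V) : flat Ω v w = -flat Ω w v := by
  rw [flat_apply, flat_apply]
  have h := Ω.toAlternatingMap.map_swap ![v, w] (i := 0) (j := 1) (by decide)
  have h2 : (![v, w] ∘ Equiv.swap (0 : Fin 2) 1) = ![w, v] := by
    ext i
    fin_cases i <;> rfl
  rw [h2] at h
  change Ω ![w, v] = -Ω ![v, w] at h
  rw [h, neg_neg]

/-- Polarization of the vanishing of `ν` on a repeated argument, applied to `v + w`. -/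
theorem interior_anticomm {k : ℕ} (v w : V) (ν : V [⋀^Fin (k + 2)]→L[ℝ] ℝ) :
    interior v (interior w ν) = -interior w (interior v ν) := by
  rw [eq_neg_iff_add_eq_zero]
  have h := ContinuousAlternatingMap.curryLeft_same ν (v + w)
  have h1 := ContinuousAlternatingMap.curryLeft_same ν v
  have h2 := ContinuousAlternatingMap.curryLeft_same ν w
  ext u
  have h' := congrArg (fun μ => μ u) h
  have h1' := congrArg (fun μ => μ u) h1
  have h2' := congrArg (fun μ => μ u) h2
  simp only [map_add, ContinuousAlternatingMap.curryLeft_add, add_apply,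
    ContinuousAlternatingMap.add_apply, ContinuousAlternatingMap.coe_zero, Pi.zero_apply] at h' h1' h2' ⊢
  simp only [interior]
  linarith

variable [FiniteDimensional ℝ V]

/-- Exterior multiplication of forms by a covector on the left. -/
def covectorWedge {k : ℕ} (α : Module.Dual ℝ V) (ν : V [⋀^Fin k]→L[ℝ] ℝ) :
    V [⋀^Fin (k + 1)]→L[ℝ] ℝ :=
  ContinuousAlternatingMap.alternatizeUncurryFin
    ((LinearMap.toContinuousLinearMap α).smulRight ν)

theorem covectorWedge_apply {k : ℕ} (α : Module.Dual ℝ V) (ν : V [⋀^Fin k]→L[ℝ] ℝ)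
    (v : Fin (k + 1) → V) :
    covectorWedge α ν v = ∑ i : Fin (k + 1), (-1) ^ (i : ℕ) * (α (v i) * ν (i.removeNth v)) := by
  simp [covectorWedge, ContinuousAlternatingMap.alternatizeUncurryFin_apply]

-- The coefficient `α ⊗ β + β ⊗ α` is symmetric, and alternating twice kills a symmetric bilinear
-- map, by the same mechanism as in `d² = 0`.
set_option maxSynthPendingDepth 3 in
theorem covectorWedge_anticomm {k : ℕ} (α β : Module.Dual ℝ V) (ν : V [⋀^Fin k]→L[ℝ] ℝ) :
    covectorWedge α (covectorWedge β ν) = -covectorWedge β (covectorWedge α ν) := by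
  rw [eq_neg_iff_add_eq_zero]
  let a := LinearMap.toContinuousLinearMap α
  let b := LinearMap.toContinuousLinearMap β
  let f : V →L[ℝ] V →L[ℝ] V [⋀^Fin k]→L[ℝ] ℝ := a.smulRight (b.smulRight ν)
  let g : V →L[ℝ] V →L[ℝ] V [⋀^Fin k]→L[ℝ] ℝ := b.smulRight (a.smulRight ν)
  have h := ContinuousAlternatingMap.alternatizeUncurryFin_alternatizeUncurryFinCLM_comp_of_symmetric
    (f := f + g)
    (fun x y => by
      change a x • b y • ν + b x • a y • ν = a y • b x • ν + b y • a x • ν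
      rw [smul_comm (a x), smul_comm (b x), add_comm])
  rw [← h, ContinuousLinearMap.comp_add, ContinuousAlternatingMap.alternatizeUncurryFin_add]
  congr 1
  · refine congrArg ContinuousAlternatingMap.alternatizeUncurryFin ?_
    ext x : 1
    exact (map_smul (ContinuousAlternatingMap.alternatizeUncurryFinCLM ℝ V ℝ) (α x)
      (b.smulRight ν)).symm
  · refine congrArg ContinuousAlternatingMap.alternatizeUncurryFin ?_
    ext x : 1
    exact (map_smul (ContinuousAlternatingMap.alternatizeUncurryFinCLM ℝ V ℝ) (β x)
      (a.smulRight ν)).symm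

theorem interior_covectorWedge_zero (v : V) (α : Module.Dual ℝ V) (ν : V [⋀^Fin 0]→L[ℝ] ℝ) :
    interior v (covectorWedge α ν) = α v • ν := by
  ext w
  rw [interior_apply, covectorWedge_apply]
  simp

/-- In the expansion of `α ∧ ν` on `(v, w)` the term in which `α` takes `v` is split off; in the
others `α` sits one place further right, which gives the minus sign. -/
theorem interior_covectorWedge_succ {k : ℕ} (v : V) (α : Module.Dual ℝ V)
    (ν : V [⋀^Fin (k + 1)]→L[ℝ] ℝ) :
    interior v (covectorWedge α ν) = α v • ν - covectorWedge α (interior v ν) := by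
  ext w
  rw [interior_apply, covectorWedge_apply, Fin.sum_univ_succ, ContinuousAlternatingMap.sub_apply,
    covectorWedge_apply, sub_eq_add_neg, ← Finset.sum_neg_distrib]
  congr 1
  · simp
  · refine Finset.sum_congr rfl fun i _ => ?_
    rw [interior_apply]
    have : i.succ.removeNth (Matrix.vecCons v w) = Matrix.vecCons v (i.removeNth w) := by
      ext j
      refine Fin.cases ?_ (fun j => ?_) j <;> simp [Fin.removeNth]
    rw [this]
    simp [pow_succ]

/-- The degree (number) operator. It also shows that forms of positive degree are sums of products
with covectors. -/
theorem sum_covectorWedge_interior {ι : Type*} [Fintype ι] (b : Module.Basis ι ℝ V) {k : ℕ}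
    (ν : V [⋀^Fin (k + 1)]→L[ℝ] ℝ) :
    ∑ a, covectorWedge (b.coord a) (interior (b a) ν) = ((k : ℝ) + 1) • ν := by
  have h := ContinuousAlternatingMap.alternatizeUncurryFin_curryLeft ν
  have h2 : ((k : ℝ) + 1) • ν = (k + 1) • ν := by
    rw [← Nat.cast_smul_eq_nsmul ℝ]
    push_cast
    rfl
  rw [h2, ← h]
  simp only [covectorWedge, ← ContinuousAlternatingMap.alternatizeUncurryFinCLM_apply]
  rw [← map_sum]
  congr 1
  ext v : 1
  simp only [sum_apply, ContinuousLinearMap.smulRight_apply,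
    LinearMap.coe_toContinuousLinearMap', interior, ← map_smul, ← map_sum]
  congr 1
  exact b.sum_repr v

end Operators

/-! ### Operators on families of forms of all degrees. -/

section Graded

variable {V : Type*} [NormedAddCommGroup V] [NormedSpace ℝ V]

variable (V) in
/-- Families consisting of one form in each degree. -/
abbrev Forms : Type _ := ∀ k : ℕ, V [⋀^Fin k]→L[ℝ] ℝ

/-- The family whose only nonzero entry is `ν`, in degree `k`. -/
def single {k : ℕ} (ν : V [⋀^Fin k]→L[ℝ] ℝ) : Forms V := Pi.single k ν

@[simp]
theorem single_same {k : ℕ} (ν : V [⋀^Fin k]→L[ℝ] ℝ) : single ν k = ν := Pi.single_eq_same _ _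

theorem single_of_ne {k l : ℕ} (h : l ≠ k) (ν : V [⋀^Fin k]→L[ℝ] ℝ) : single ν l = 0 :=
  Pi.single_eq_of_ne h _

theorem single_injective {k : ℕ} {μ ν : V [⋀^Fin k]→L[ℝ] ℝ} (h : single μ = single ν) : μ = ν := by
  rw [← single_same μ, h, single_same]

/-- Reading a family in another degree absorbs the transport along an equality of degrees. -/
theorem single_castDegree {k l : ℕ} (h : k = l) (ν : V [⋀^Fin k]→L[ℝ] ℝ) :
    castDegree h ν = single ν l := by
  subst h
  rw [single_same]
  rfl

theorem single_smul {k : ℕ} (c : ℝ) (ν : V [⋀^Fin k]→L[ℝ] ℝ) : single (c • ν) = c • single ν :=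
  Pi.single_smul _ _ _

theorem single_add {k : ℕ} (μ ν : V [⋀^Fin k]→L[ℝ] ℝ) : single (μ + ν) = single μ + single ν :=
  Pi.single_add _ _ _

theorem single_sub {k : ℕ} (μ ν : V [⋀^Fin k]→L[ℝ] ℝ) : single (μ - ν) = single μ - single ν :=
  Pi.single_sub _ _ _

theorem single_zero {k : ℕ} : single (0 : V [⋀^Fin k]→L[ℝ] ℝ) = 0 := Pi.single_zero _

theorem single_sum {ι : Type*} (s : Finset ι) {k : ℕ} (ν : ι → V [⋀^Fin k]→L[ℝ] ℝ) :
    single (∑ a ∈ s, ν a) = ∑ a ∈ s, single (ν a) :=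
  map_sum (AddMonoidHom.single (fun k : ℕ => V [⋀^Fin k]→L[ℝ] ℝ) k) ν s

/-- Contraction of families of forms by a vector. -/
def int : V →ₗ[ℝ] Module.End ℝ (Forms V) :=
  LinearMap.mk₂ ℝ (fun v F k => interior v (F (k + 1)))
    (fun v w F => by ext k : 1; simp [interior])
    (fun c v F => by ext k : 1; simp [interior])
    (fun v F G => by ext k : 1; simp [interior])
    (fun c v F => by ext k : 1; simp [interior])

theorem int_apply (v : V) (F : Forms V) (k : ℕ) : int v F k = interior v (F (k + 1)) := rfl

theorem int_single_succ (v : V) {k : ℕ} (ν : V [⋀^Fin (k + 1)]→L[ℝ] ℝ) :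
    int v (single ν) = single (interior v ν) := by
  ext l : 1
  rw [int_apply]
  rcases eq_or_ne l k with rfl | h
  · simp
  · rw [single_of_ne h, single_of_ne (by omega)]
    rfl

theorem int_single_zero (v : V) (ν : V [⋀^Fin 0]→L[ℝ] ℝ) : int v (single ν) = 0 := by
  ext l : 1
  rw [int_apply, single_of_ne (by omega)]
  rfl

theorem int_int (v w : V) (F : Forms V) : int v (int w F) = -int w (int v F) := by
  ext k : 1
  exact interior_anticomm v w _

variable [FiniteDimensional ℝ V]

/-- Left exterior multiplication of families of forms by a covector. -/
def ext : Module.Dual ℝ V →ₗ[ℝ] Module.End ℝ (Forms V) :=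
  LinearMap.mk₂ ℝ
    (fun α F k => match k with
      | 0 => 0
      | k + 1 => covectorWedge α (F k))
    (fun α β F => by
      ext k : 1
      cases k
      · simp
      · ext v
        simp [covectorWedge_apply, mul_add, add_mul, Finset.sum_add_distrib])
    (fun c α F => by
      ext k : 1
      cases k
      · simp
      · ext v
        simp [covectorWedge_apply, Finset.mul_sum]
        exact Finset.sum_congr rfl fun i _ => by ring)
    (fun α F G => by
      ext k : 1
      cases k
      · simp
      · ext v
        simp [covectorWedge_apply, mul_add, Finset.sum_add_distrib])
    (fun c α F => by
      ext k : 1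
      cases k
      · simp
      · ext v
        simp [covectorWedge_apply, Finset.mul_sum]
        exact Finset.sum_congr rfl fun i _ => by ring)

theorem ext_apply_zero (α : Module.Dual ℝ V) (F : Forms V) : ext α F 0 = 0 := rfl

theorem ext_apply_succ (α : Module.Dual ℝ V) (F : Forms V) (k : ℕ) :
    ext α F (k + 1) = covectorWedge α (F k) := rfl

theorem covectorWedge_zero {k : ℕ} (α : Module.Dual ℝ V) :
    covectorWedge α (0 : V [⋀^Fin k]→L[ℝ] ℝ) = 0 := by
  ext v
  simp [covectorWedge_apply]

theorem ext_single (α : Module.Dual ℝ V) {k : ℕ} (ν : V [⋀^Fin k]→L[ℝ] ℝ) :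
    ext α (single ν) = single (covectorWedge α ν) := by
  ext l : 1
  cases l with
  | zero => rw [ext_apply_zero, single_of_ne (by omega)]
  | succ l =>
    rw [ext_apply_succ]
    rcases eq_or_ne l k with rfl | h
    · simp
    · rw [single_of_ne h, single_of_ne (by omega), covectorWedge_zero]

theorem ext_ext (α β : Module.Dual ℝ V) (F : Forms V) : ext α (ext β F) = -ext β (ext α F) := by
  ext k : 1
  match k with
  | 0 => simp [ext_apply_zero]
  | 1 =>
    rw [Pi.neg_apply, ext_apply_succ, ext_apply_succ, ext_apply_zero, ext_apply_zero,
      covectorWedge_zero, covectorWedge_zero, neg_zero]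
  | k + 2 => exact covectorWedge_anticomm α β _

/-- With `int_int` and `ext_ext`, the canonical anticommutation relations behind the commutators
below. -/
theorem int_ext (v : V) (α : Module.Dual ℝ V) (F : Forms V) :
    int v (ext α F) = α v • F - ext α (int v F) := by
  ext k : 1
  rw [int_apply, Pi.sub_apply, Pi.smul_apply, ext_apply_succ]
  cases k with
  | zero => rw [interior_covectorWedge_zero, ext_apply_zero, sub_zero]
  | succ k => rw [interior_covectorWedge_succ, ext_apply_succ, int_apply]

variable {ι : Type*} [Fintype ι] (b : Module.Basis ι ℝ V)

theorem sum_ext_int_apply (F : Forms V) (k : ℕ) :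
    (∑ a, ext (b.coord a) (int (b a) F)) k = (k : ℝ) • F k := by
  rw [Finset.sum_apply]
  cases k with
  | zero => simp [ext_apply_zero]
  | succ k =>
    simp only [ext_apply_succ, int_apply]
    rw [sum_covectorWedge_interior]
    push_cast
    rfl

omit [FiniteDimensional ℝ V] in
theorem sum_apply_smul_coord (φ : Module.Dual ℝ V) : ∑ a, φ (b a) • b.coord a = φ := by
  refine b.ext fun c => ?_
  simp

omit [FiniteDimensional ℝ V] in
theorem sum_coord_smul (v : V) : ∑ a, b.coord a v • b a = v := b.sum_repr v

omit [FiniteDimensional ℝ V] in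
/-- The contraction of a bilinear map with the identity tensor does not depend on the basis. -/
theorem sum_basis_coord_eq {κ X : Type*} [Fintype κ] [AddCommGroup X] [Module ℝ X]
    (b' : Module.Basis κ ℝ V)
    (B : V →ₗ[ℝ] Module.Dual ℝ V →ₗ[ℝ] X) :
    ∑ a, B (b a) (b.coord a) = ∑ c, B (b' c) (b'.coord c) := by
  have h : ∀ a, B (b a) (b.coord a) = ∑ c, B (b' c) (b'.coord c (b a) • b.coord a) := fun a => by
    conv_lhs => rw [← sum_coord_smul b' (b a)]
    simp only [map_sum, map_smul, LinearMap.sum_apply, LinearMap.smul_apply]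
  simp only [h]
  rw [Finset.sum_comm]
  refine Finset.sum_congr rfl fun c _ => ?_
  rw [← map_sum, sum_apply_smul_coord]

end Graded

/-! ### The Lefschetz operators and their commutator. -/

section Lefschetz

variable {V : Type*} [NormedAddCommGroup V] [NormedSpace ℝ V]

variable (V) in
/-- The form of degree `0` with value `1`. -/
def one : V [⋀^Fin 0]→L[ℝ] ℝ := ContinuousAlternatingMap.constOfIsEmpty ℝ V (Fin 0) 1

theorem flat_add_left (τ τ' : V [⋀^Fin 2]→L[ℝ] ℝ) (v : V) :
    flat (τ + τ') v = flat τ v + flat τ' v := by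
  ext w
  simp [flat_apply]

theorem flat_smul_left (c : ℝ) (τ : V [⋀^Fin 2]→L[ℝ] ℝ) (v : V) :
    flat (c • τ) v = c • flat τ v := by
  ext w
  simp [flat_apply]

variable [FiniteDimensional ℝ V]

theorem flat_sharp {Ω : V [⋀^Fin 2]→L[ℝ] ℝ} (h : Nondegenerate Ω) (φ : Module.Dual ℝ V) :
    flat Ω (sharp Ω h φ) = φ :=
  ((flat Ω).linearEquivOfInjective (flat_injective h) _).apply_symm_apply φ

theorem sharp_flat {Ω : V [⋀^Fin 2]→L[ℝ] ℝ} (h : Nondegenerate Ω) (v : V) :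
    sharp Ω h (flat Ω v) = v :=
  ((flat Ω).linearEquivOfInjective (flat_injective h) _).symm_apply_apply v

theorem apply_sharp {Ω : V [⋀^Fin 2]→L[ℝ] ℝ} (h : Nondegenerate Ω) (φ χ : Module.Dual ℝ V) :
    φ (sharp Ω h χ) = -χ (sharp Ω h φ) := by
  conv_lhs => rw [← flat_sharp h φ]
  rw [flat_antisymm, flat_sharp]

theorem covectorWedge_one (φ : Module.Dual ℝ V) (w : Fin 1 → V) :
    covectorWedge φ (one V) w = φ (w 0) := by
  simp [covectorWedge_apply, one]

theorem interior_two_form (τ : V [⋀^Fin 2]→L[ℝ] ℝ) (v : V) :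
    interior v τ = covectorWedge (flat τ v) (one V) := by
  ext w
  rw [covectorWedge_one, interior_apply, flat_apply]
  congr 1
  ext i
  fin_cases i <;> rfl

theorem oneForm_covector (α : V [⋀^Fin 1]→L[ℝ] ℝ) : α = covectorWedge (covector α) (one V) := by
  ext w
  rw [covectorWedge_one]
  change α w = α (fun _ => w 0)
  congr 1
  ext i
  fin_cases i
  rfl

/-- The operator of exterior multiplication by a `2`-form. -/
def lefschetz (τ : V [⋀^Fin 2]→L[ℝ] ℝ) : Module.End ℝ (Forms V) :=
  (2⁻¹ : ℝ) • ∑ a, ext ((Module.finBasis ℝ V).coord a) * ext (flat τ (Module.finBasis ℝ V a))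

theorem lefschetz_apply (τ : V [⋀^Fin 2]→L[ℝ] ℝ) (F : Forms V) :
    lefschetz τ F = (2⁻¹ : ℝ) • ∑ a, ext ((Module.finBasis ℝ V).coord a)
      (ext (flat τ (Module.finBasis ℝ V a)) F) := by
  simp [lefschetz]

theorem lefschetz_add (τ τ' : V [⋀^Fin 2]→L[ℝ] ℝ) :
    lefschetz (τ + τ') = lefschetz τ + lefschetz τ' := by
  simp [lefschetz, flat_add_left, mul_add, Finset.sum_add_distrib]

theorem lefschetz_smul (c : ℝ) (τ : V [⋀^Fin 2]→L[ℝ] ℝ) :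
    lefschetz (c • τ) = c • lefschetz τ := by
  simp only [lefschetz, flat_smul_left, map_smul, mul_smul_comm, ← Finset.smul_sum]
  rw [smul_comm]

theorem lefschetz_ext (τ : V [⋀^Fin 2]→L[ℝ] ℝ) (α : Module.Dual ℝ V) (F : Forms V) :
    lefschetz τ (ext α F) = ext α (lefschetz τ F) := by
  simp only [lefschetz_apply, map_smul, map_sum]
  congr 1
  refine Finset.sum_congr rfl fun a _ => ?_
  rw [ext_ext _ α, map_neg, ext_ext _ α, neg_neg]

theorem lefschetz_lefschetz (τ τ' : V [⋀^Fin 2]→L[ℝ] ℝ) (F : Forms V) :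
    lefschetz τ (lefschetz τ' F) = lefschetz τ' (lefschetz τ F) := by
  rw [lefschetz_apply τ', map_smul, map_sum, lefschetz_apply τ' (lefschetz τ F)]
  simp only [lefschetz_ext]

/-- The factor `1/2` in `lefschetz` cancels the eigenvalue 2 of the degree operator on 2-forms. -/
theorem lefschetz_one (τ : V [⋀^Fin 2]→L[ℝ] ℝ) : lefschetz τ (single (one V)) = single τ := by
  have h := sum_covectorWedge_interior (Module.finBasis ℝ V) τ
  simp only [interior_two_form] at h
  rw [lefschetz_apply]
  simp only [ext_single]
  rw [← single_sum, h, single_smul, smul_smul]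
  norm_num

/-- Anticommuting `i(v)` past the two factors of `lefschetz` yields two scalar contributions. Each
is half of `i(v)τ ∧ F`: one by expanding `v` in the basis, the other by expanding `i(v)τ` in the
dual basis and using antisymmetry. -/
theorem int_lefschetz (τ : V [⋀^Fin 2]→L[ℝ] ℝ) (v : V) (F : Forms V) :
    int v (lefschetz τ F) = ext (flat τ v) F + lefschetz τ (int v F) := by
  have h1 : ext (flat τ v) F
      = ∑ a, (Module.finBasis ℝ V).coord a v • ext (flat τ (Module.finBasis ℝ V a)) F := by
    conv_lhs => rw [← sum_coord_smul (Module.finBasis ℝ V) v]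
    simp only [map_sum, map_smul, LinearMap.sum_apply, LinearMap.smul_apply]
  have h2 : ext (flat τ v) F
      = -∑ a, flat τ (Module.finBasis ℝ V a) v • ext ((Module.finBasis ℝ V).coord a) F := by
    conv_lhs => rw [← sum_apply_smul_coord (Module.finBasis ℝ V) (flat τ v)]
    simp only [map_sum, map_smul, LinearMap.sum_apply, LinearMap.smul_apply,
      flat_antisymm τ v, neg_smul, Finset.sum_neg_distrib]
  have h3 : ext (flat τ v) F = (2⁻¹ : ℝ) • (ext (flat τ v) F + ext (flat τ v) F) := by
    rw [← two_smul ℝ, smul_smul]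
    norm_num
  rw [h3]
  nth_rw 1 [h1]
  rw [h2, lefschetz_apply, lefschetz_apply, map_smul, map_sum, ← smul_add]
  congr 1
  rw [← sub_eq_add_neg, ← Finset.sum_sub_distrib, ← Finset.sum_add_distrib]
  refine Finset.sum_congr rfl fun a _ => ?_
  rw [int_ext, int_ext, map_sub, map_smul]
  abel

variable {Ω : V [⋀^Fin 2]→L[ℝ] ℝ} (h : Nondegenerate Ω)

variable (Ω) in
/-- The dual Lefschetz operator on families of forms. -/
def dualLefschetz (h : Nondegenerate Ω) : Module.End ℝ (Forms V) :=
  (2⁻¹ : ℝ) • ∑ a, int (Module.finBasis ℝ V a) * int (sharp Ω h ((Module.finBasis ℝ V).coord a))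

theorem dualLefschetz_apply (F : Forms V) :
    dualLefschetz Ω h F = (2⁻¹ : ℝ) • ∑ a, int (Module.finBasis ℝ V a)
      (int (sharp Ω h ((Module.finBasis ℝ V).coord a)) F) := by
  simp [dualLefschetz]

/-- The mirror image of `int_lefschetz`: the two contractions in `Λ` each contribute half of
`i(♯β)`. -/
theorem dualLefschetz_ext (β : Module.Dual ℝ V) (F : Forms V) :
    dualLefschetz Ω h (ext β F) = ext β (dualLefschetz Ω h F) - int (sharp Ω h β) F := by
  have h1 : int (sharp Ω h β) F = ∑ a, β (Module.finBasis ℝ V a) •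
      int (sharp Ω h ((Module.finBasis ℝ V).coord a)) F := by
    conv_lhs => rw [← sum_apply_smul_coord (Module.finBasis ℝ V) β]
    simp only [map_sum, map_smul, LinearMap.sum_apply, LinearMap.smul_apply]
  have h2 : int (sharp Ω h β) F = -∑ a, β (sharp Ω h ((Module.finBasis ℝ V).coord a)) •
      int (Module.finBasis ℝ V a) F := by
    conv_lhs => rw [← sum_coord_smul (Module.finBasis ℝ V) (sharp Ω h β)]
    simp only [map_neg, map_sum, map_smul, LinearMap.neg_apply, LinearMap.sum_apply,
      LinearMap.smul_apply, apply_sharp h _ β, neg_smul, Finset.sum_neg_distrib]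
  have h3 : int (sharp Ω h β) F
      = (2⁻¹ : ℝ) • (int (sharp Ω h β) F + int (sharp Ω h β) F) := by
    rw [← two_smul ℝ, smul_smul]
    norm_num
  rw [h3]
  nth_rw 1 [h1]
  rw [h2, dualLefschetz_apply, dualLefschetz_apply, map_smul, map_sum]
  refine Eq.trans ?_ (smul_sub (2⁻¹ : ℝ) _ _)
  congr 1
  rw [← sub_eq_add_neg, ← Finset.sum_sub_distrib, ← Finset.sum_sub_distrib]
  refine Finset.sum_congr rfl fun a _ => ?_
  rw [int_ext, map_sub, map_smul, int_ext]
  abel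

/-- The vectors `♯e^a` form a basis whose dual basis is `-♭e_a`, so the sum is minus the degree
operator written in another basis. -/
theorem sum_ext_flat_int_sharp (F : Forms V) :
    ∑ a, ext (flat Ω (Module.finBasis ℝ V a))
        (int (sharp Ω h ((Module.finBasis ℝ V).coord a)) F)
      = -∑ a, ext ((Module.finBasis ℝ V).coord a) (int (Module.finBasis ℝ V a) F) := by
  have h1 : ∀ a, flat Ω (Module.finBasis ℝ V a)
      = ∑ c, flat Ω (Module.finBasis ℝ V a) (Module.finBasis ℝ V c) •
        (Module.finBasis ℝ V).coord c := fun a => (sum_apply_smul_coord _ _).symm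
  have h2 : ∀ c, Module.finBasis ℝ V c = -∑ a, flat Ω (Module.finBasis ℝ V a)
      (Module.finBasis ℝ V c) • sharp Ω h ((Module.finBasis ℝ V).coord a) := fun c => by
    conv_lhs => rw [← sharp_flat h (Module.finBasis ℝ V c),
      ← sum_apply_smul_coord (Module.finBasis ℝ V) (flat Ω (Module.finBasis ℝ V c))]
    simp only [map_sum, map_smul, flat_antisymm Ω (Module.finBasis ℝ V c), neg_smul,
      Finset.sum_neg_distrib]
  have h3 : ∀ c, int (Module.finBasis ℝ V c) F = -∑ a, flat Ω (Module.finBasis ℝ V a)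
      (Module.finBasis ℝ V c) • int (sharp Ω h ((Module.finBasis ℝ V).coord a)) F := fun c => by
    conv_lhs => rw [h2 c]
    simp only [map_neg, map_sum, map_smul, LinearMap.neg_apply, LinearMap.sum_apply,
      LinearMap.smul_apply]
  have h4 : ∀ a (G : Forms V), ext (flat Ω (Module.finBasis ℝ V a)) G
      = ∑ c, flat Ω (Module.finBasis ℝ V a) (Module.finBasis ℝ V c) •
        ext ((Module.finBasis ℝ V).coord c) G := fun a G => by
    conv_lhs => rw [h1 a]
    simp only [map_sum, map_smul, LinearMap.sum_apply, LinearMap.smul_apply]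
  simp only [h3, h4, map_neg, map_sum, map_smul, Finset.sum_neg_distrib, neg_neg]
  exact Finset.sum_comm

/-- The `sl₂` relation. Commuting `Λ` past `e^a ∧ ♭e_a ∧` leaves, after summation over `a`, the
dimension `2n` and twice minus the degree operator; halving gives `n - k`. -/
theorem dualLefschetz_lefschetz {n : ℕ} (hn : Module.finrank ℝ V = 2 * n) (F : Forms V) (k : ℕ) :
    dualLefschetz Ω h (lefschetz Ω F) k
      = lefschetz Ω (dualLefschetz Ω h F) k + ((n : ℝ) - k) • F k := by
  have h1 : ∀ a, dualLefschetz Ω h (ext ((Module.finBasis ℝ V).coord a)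
        (ext (flat Ω (Module.finBasis ℝ V a)) F))
      = ext ((Module.finBasis ℝ V).coord a) (ext (flat Ω (Module.finBasis ℝ V a))
          (dualLefschetz Ω h F))
        - ext ((Module.finBasis ℝ V).coord a) (int (Module.finBasis ℝ V a) F)
        + F + ext (flat Ω (Module.finBasis ℝ V a))
          (int (sharp Ω h ((Module.finBasis ℝ V).coord a)) F) := fun a => by
    rw [dualLefschetz_ext, dualLefschetz_ext, map_sub, sharp_flat, int_ext,
      flat_antisymm, flat_sharp]
    simp only [Module.Basis.coord_apply, Module.Basis.repr_self, Finsupp.single_eq_same]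
    module
  have h2 : dualLefschetz Ω h (lefschetz Ω F) = lefschetz Ω (dualLefschetz Ω h F)
      + (2⁻¹ : ℝ) • ((2 * n : ℝ) • F
        - (2 : ℝ) • ∑ a, ext ((Module.finBasis ℝ V).coord a) (int (Module.finBasis ℝ V a) F)) := by
    rw [lefschetz_apply, lefschetz_apply, map_smul, map_sum, ← smul_add]
    congr 1
    simp only [h1, Finset.sum_add_distrib, Finset.sum_sub_distrib, sum_ext_flat_int_sharp]
    have h3 : (Module.finrank ℝ V : ℝ) = 2 * n := by
      rw [hn]
      push_cast
      rfl
    rw [Finset.sum_const, Finset.card_univ, Fintype.card_fin, ← Nat.cast_smul_eq_nsmul ℝ, h3]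
    module
  rw [h2, Pi.add_apply, Pi.smul_apply, Pi.sub_apply, Pi.smul_apply, Pi.smul_apply,
    sum_ext_int_apply]
  congr 1
  module

end Lefschetz

/-! ### The exterior product expressed through these operators. -/

section Wedge

variable {V : Type*} [NormedAddCommGroup V] [NormedSpace ℝ V]

/-- The signed sum of a function over all permutations of its arguments. -/
def altSum {W : Type*} {k : ℕ} (f : (Fin k → W) → ℝ) (v : Fin k → W) : ℝ :=
  ∑ s : Equiv.Perm (Fin k), ((Equiv.Perm.sign s : ℤ) : ℝ) * f (v ∘ s)

theorem altSum_comp_perm {W : Type*} {k : ℕ} (f : (Fin k → W) → ℝ) (π : Equiv.Perm (Fin k))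
    (v : Fin k → W) :
    altSum (fun u => f (u ∘ π)) v = ((Equiv.Perm.sign π : ℤ) : ℝ) * altSum f v := by
  rw [altSum, altSum, Finset.mul_sum]
  refine Fintype.sum_equiv (Equiv.mulRight π) _ _ fun s => ?_
  rw [Equiv.coe_mulRight, Equiv.Perm.sign_mul, Equiv.Perm.coe_mul, Function.comp_assoc,
    Units.val_mul, Int.cast_mul]
  have h : ((Equiv.Perm.sign π : ℤ) : ℝ) * ((Equiv.Perm.sign π : ℤ) : ℝ) = 1 := by
    rw [← Int.cast_mul, ← Units.val_mul, Int.units_mul_self]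
    simp
  linear_combination (-((Equiv.Perm.sign s : ℤ) : ℝ) * f (v ∘ s ∘ π)) * h

theorem altSum_sum {W ι : Type*} {k : ℕ} (t : Finset ι) (f : ι → (Fin k → W) → ℝ) (v : Fin k → W) :
    altSum (fun u => ∑ a ∈ t, f a u) v = ∑ a ∈ t, altSum (f a) v := by
  simp only [altSum, Finset.mul_sum]
  exact Finset.sum_comm

theorem altSum_mul {W : Type*} {k : ℕ} (c : ℝ) (f : (Fin k → W) → ℝ) (v : Fin k → W) :
    altSum (fun u => c * f u) v = c * altSum f v := by
  simp only [altSum, Finset.mul_sum]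
  exact Finset.sum_congr rfl fun s _ => by ring

theorem altSum_form {k : ℕ} (ν : V [⋀^Fin k]→L[ℝ] ℝ) (v : Fin k → V) :
    altSum ν v = (k.factorial : ℝ) * ν v := by
  have h : ∀ s : Equiv.Perm (Fin k), ((Equiv.Perm.sign s : ℤ) : ℝ) * ν (v ∘ s) = ν v := by
    intro s
    have h1 := ν.toAlternatingMap.map_perm v s
    change ν (v ∘ s) = _ • ν v at h1
    rw [h1, Units.smul_def, ← Int.cast_smul_eq_zsmul ℝ, smul_eq_mul, ← mul_assoc, ← Int.cast_mul,
      ← Units.val_mul, Int.units_mul_self]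
    simp
  simp only [altSum, h, Finset.sum_const, Finset.card_univ, Fintype.card_perm, Fintype.card_fin,
    nsmul_eq_mul]

theorem wedge_apply {k l : ℕ} (α : V [⋀^Fin k]→L[ℝ] ℝ) (β : V [⋀^Fin l]→L[ℝ] ℝ)
    (v : Fin (k + l) → V) :
    wedge α β v = ((k.factorial : ℝ) * (l.factorial : ℝ))⁻¹ *
      altSum (fun u => α (fun i => u (Fin.castAdd l i)) * β (fun i => u (Fin.natAdd k i))) v := by
  rw [wedge, ContinuousAlternatingMap.smul_apply, smul_eq_mul,
    ContinuousMultilinearMap.alternatization_apply_apply, altSum]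
  congr 1
  refine Finset.sum_congr rfl fun s _ => ?_
  rw [Units.smul_def, ← Int.cast_smul_eq_zsmul ℝ, smul_eq_mul]
  rfl

variable [FiniteDimensional ℝ V]

/-- The signed sum of `α ∧ ν` is computed in two ways: it is `(k + 1)!` times the form, and each of
the `k + 1` terms of its expansion contributes the same amount, since the cycle moving place `i` to
the front has sign `(-1)^i`. -/
theorem altSum_covector_form {k : ℕ} (α : Module.Dual ℝ V) (ν : V [⋀^Fin k]→L[ℝ] ℝ)
    (v : Fin (k + 1) → V) :
    altSum (fun u : Fin (k + 1) → V => α (u 0) * ν (fun i => u i.succ)) v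
      = (k.factorial : ℝ) * covectorWedge α ν v := by
  have h1 := altSum_form (covectorWedge α ν) v
  have h2 : altSum (covectorWedge α ν) v = ((k : ℝ) + 1) *
      altSum (fun u : Fin (k + 1) → V => α (u 0) * ν (fun i => u i.succ)) v := by
    have h3 : (⇑(covectorWedge α ν) : (Fin (k + 1) → V) → ℝ) = fun u =>
        ∑ i : Fin (k + 1), (-1 : ℝ) ^ (i : ℕ) * (α (u i) * ν (i.removeNth u)) :=
      funext fun u => covectorWedge_apply α ν u
    rw [h3, altSum_sum]
    have h4 : ∀ i : Fin (k + 1),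
        altSum (fun u : Fin (k + 1) → V =>
          (-1 : ℝ) ^ (i : ℕ) * (α (u i) * ν (i.removeNth u))) v
        = altSum (fun u : Fin (k + 1) → V => α (u 0) * ν (fun i => u i.succ)) v := by
      intro i
      rw [altSum_mul]
      have h5 := altSum_comp_perm
        (fun u : Fin (k + 1) → V => α (u 0) * ν (fun i => u i.succ)) i.cycleRange.symm v
      have h6 : (fun u : Fin (k + 1) → V => α (u i) * ν (i.removeNth u)) =
          fun u => α ((u ∘ i.cycleRange.symm) 0) *
            ν (fun j => (u ∘ i.cycleRange.symm) j.succ) := by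
        ext u
        simp only [Function.comp_apply, Fin.cycleRange_symm_zero, Fin.cycleRange_symm_succ]
        rfl
      rw [h6, h5, Equiv.Perm.sign_symm, Fin.sign_cycleRange]
      push_cast
      rw [← mul_assoc, ← mul_pow]
      simp
    simp only [h4, Finset.sum_const, Finset.card_univ, Fintype.card_fin, nsmul_eq_mul]
    push_cast
    rfl
  rw [h2, Nat.factorial_succ] at h1
  push_cast at h1
  have h7 : (k : ℝ) + 1 ≠ 0 := by positivity
  rw [mul_assoc] at h1
  exact mul_left_cancel₀ h7 h1

/-- Antisymmetrization in stages: alternating the last `k` arguments beforehand only multiplies the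
full signed sum by `k!`. Here `f` need not be alternating, so the lemma can be iterated. -/
theorem altSum_covector {k : ℕ} (α : Module.Dual ℝ V) (f : (Fin k → V) → ℝ)
    (μ : V [⋀^Fin k]→L[ℝ] ℝ) (hf : ∀ u, altSum f u = μ u) (v : Fin (k + 1) → V) :
    altSum (fun u : Fin (k + 1) → V => α (u 0) * f (fun i => u i.succ)) v
      = covectorWedge α μ v := by
  have h1 := altSum_covector_form α μ v
  have h2 : altSum (fun u : Fin (k + 1) → V => α (u 0) * μ (fun i => u i.succ)) v
      = (k.factorial : ℝ) *
        altSum (fun u : Fin (k + 1) → V => α (u 0) * f (fun i => u i.succ)) v := by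
    have h3 : (fun u : Fin (k + 1) → V => α (u 0) * μ (fun i => u i.succ)) = fun u =>
        ∑ e : Equiv.Perm (Fin k), ((Equiv.Perm.sign e : ℤ) : ℝ) *
          (α (u 0) * f ((fun i => u i.succ) ∘ e)) := by
      ext u
      rw [← hf, altSum, Finset.mul_sum]
      exact Finset.sum_congr rfl fun e _ => by ring
    rw [h3, altSum_sum]
    have h4 : ∀ e : Equiv.Perm (Fin k),
        altSum (fun u : Fin (k + 1) → V => ((Equiv.Perm.sign e : ℤ) : ℝ) *
          (α (u 0) * f ((fun i => u i.succ) ∘ e))) v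
        = altSum (fun u : Fin (k + 1) → V => α (u 0) * f (fun i => u i.succ)) v := by
      intro e
      rw [altSum_mul]
      have h5 := altSum_comp_perm
        (fun u : Fin (k + 1) → V => α (u 0) * f (fun i => u i.succ))
        -- The extension of `e` to `Fin (k + 1)` that fixes `0`; it has the sign of `e`.
        (Equiv.Perm.decomposeFin.symm (0, e)) v
      have h6 : (fun u : Fin (k + 1) → V => α (u 0) * f ((fun i => u i.succ) ∘ e)) =
          fun u => α ((u ∘ Equiv.Perm.decomposeFin.symm (0, e)) 0) *
            f (fun j => (u ∘ Equiv.Perm.decomposeFin.symm (0, e)) j.succ) := by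
        ext u
        simp only [Function.comp_apply, Equiv.Perm.decomposeFin_symm_apply_zero,
          Equiv.Perm.decomposeFin_symm_apply_succ, Equiv.swap_self, Equiv.refl_apply]
        rfl
      rw [h6, h5, Equiv.Perm.decomposeFin.symm_sign]
      rw [← mul_assoc]
      simp only [if_true, one_mul]
      rw [← Int.cast_mul, ← Units.val_mul, Int.units_mul_self]
      simp
    simp only [h4, Finset.sum_const, Finset.card_univ, Fintype.card_perm, Fintype.card_fin,
      nsmul_eq_mul]
  rw [h2] at h1
  exact mul_left_cancel₀ (by positivity) h1

theorem wedge_covector {l : ℕ} (α : V [⋀^Fin 1]→L[ℝ] ℝ) (β : V [⋀^Fin l]→L[ℝ] ℝ)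
    (v : Fin (1 + l) → V) :
    wedge α β v = covectorWedge (covector α) β (v ∘ Fin.cast (add_comm l 1)) := by
  have key : ∀ (m : ℕ) (hm : l + 1 = m) (v : Fin m → V),
      altSum (fun u => covector α (u (Fin.cast hm 0)) * β (fun i => u (Fin.cast hm i.succ))) v
        = (l.factorial : ℝ) * covectorWedge (covector α) β (v ∘ Fin.cast hm) := by
    rintro _ rfl v
    exact altSum_covector_form (covector α) β v
  have h := key _ (add_comm l 1) v
  have h2 : (fun u : Fin (1 + l) → V =>
      α (fun i => u (Fin.castAdd l i)) * β (fun i => u (Fin.natAdd 1 i))) = fun u =>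
      covector α (u (Fin.cast (add_comm l 1) 0)) *
        β (fun i => u (Fin.cast (add_comm l 1) i.succ)) := by
    ext u
    congr 1
    · change _ = α (fun _ => u (Fin.cast (add_comm l 1) 0))
      congr 1
      ext i
      congr 1
      ext
      simp
    · congr 1
      ext i
      congr 1
      ext
      simp [add_comm]
  rw [wedge_apply, h2, h, ← mul_assoc]
  simp [Nat.factorial_ne_zero]

theorem single_wedge_one_one (α β : V [⋀^Fin 1]→L[ℝ] ℝ) :
    single (wedge α β) = ext (covector α) (single β) := by
  rw [ext_single]
  congr 1
  ext v
  exact wedge_covector α β v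

/-- The degrees `1 + 2` and `2 + 1` are the same numeral, so the transport in `wedge_covector` is
definitionally the identity. -/
theorem single_wedge_one_two (α : V [⋀^Fin 1]→L[ℝ] ℝ) (β : V [⋀^Fin 2]→L[ℝ] ℝ) :
    single (k := 3) (wedge α β) = ext (covector α) (single β) := by
  rw [ext_single]
  congr 1
  ext v
  exact wedge_covector α β v

/-- This permutation exchanges the block of the last two places with the block of the first `k`;
being a square, it is even. -/
theorem finRotate_symm_sq (k : ℕ) :
    ((finRotate (k + 2)).symm ((finRotate (k + 2)).symm 0) = Fin.natAdd k (0 : Fin 2)) ∧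
    ((finRotate (k + 2)).symm ((finRotate (k + 2)).symm 1) = Fin.natAdd k (1 : Fin 2)) ∧
    ∀ i : Fin k, (finRotate (k + 2)).symm ((finRotate (k + 2)).symm i.succ.succ)
      = Fin.castAdd 2 i := by
  simp only [Equiv.symm_apply_eq]
  refine ⟨?_, ?_, fun i => ?_⟩
  · ext
    simp [Fin.val_add]
  · ext
    simp [Fin.val_add]
  · ext
    have := i.isLt
    simp only [finRotate_apply, Fin.val_add, Fin.val_succ, Fin.val_castAdd, Fin.val_one]
    rw [Nat.mod_eq_of_lt, Nat.mod_eq_of_lt]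
    · omega
    · rw [Nat.mod_eq_of_lt] <;> omega

/-- An even permutation moves `τ` to the front, where it is expanded as the sum of `e^a ⊗ i(e_a)τ`;
antisymmetrization in stages produces `k!`, and `k! / (k! 2!)` is the factor `1/2` of `lefschetz`.
-/
theorem single_wedge_two {k : ℕ} (ν : V [⋀^Fin k]→L[ℝ] ℝ) (τ : V [⋀^Fin 2]→L[ℝ] ℝ) :
    single (wedge ν τ) = lefschetz τ (single ν) := by
  have h0 : ∀ (β : Module.Dual ℝ V) (u : Fin (k + 1) → V),
      altSum (fun u : Fin (k + 1) → V => β (u 0) * ν (fun i => u i.succ)) u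
        = ((k.factorial : ℝ) • covectorWedge β ν) u := fun β u =>
    altSum_covector_form β ν u
  have h1 : ∀ (α β : Module.Dual ℝ V) (v : Fin (k + 2) → V),
      altSum (fun u : Fin (k + 2) → V => α (u 0) * (β (u 1) * ν (fun i => u i.succ.succ))) v
        = covectorWedge α ((k.factorial : ℝ) • covectorWedge β ν) v := fun α β v =>
    altSum_covector α (fun u : Fin (k + 1) → V => β (u 0) * ν (fun i => u i.succ)) _ (h0 β) v
  have h2 : ∀ v : Fin (k + 2) → V,
      altSum (fun u : Fin (k + 2) → V => τ ![u 0, u 1] * ν (fun i => u i.succ.succ)) v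
        = ∑ a, covectorWedge ((Module.finBasis ℝ V).coord a)
          ((k.factorial : ℝ) • covectorWedge (flat τ (Module.finBasis ℝ V a)) ν) v := by
    intro v
    simp only [← h1]
    rw [← altSum_sum]
    congr 1
    ext u
    rw [← flat_apply]
    conv_lhs => rw [← sum_coord_smul (Module.finBasis ℝ V) (u 0)]
    simp only [map_sum, map_smul, LinearMap.sum_apply, LinearMap.smul_apply, Finset.sum_mul,
      smul_eq_mul, mul_assoc]
  have h3 : wedge ν τ = (2⁻¹ : ℝ) • ∑ a, covectorWedge ((Module.finBasis ℝ V).coord a)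
      (covectorWedge (flat τ (Module.finBasis ℝ V a)) ν) := by
    ext v
    obtain ⟨r0, r1, r2⟩ := finRotate_symm_sq k
    let π : Equiv.Perm (Fin (k + 2)) := (finRotate (k + 2)).symm * (finRotate (k + 2)).symm
    have h4 : (fun u : Fin (k + 2) → V =>
        ν (fun i => u (Fin.castAdd 2 i)) * τ (fun i => u (Fin.natAdd k i))) = fun u =>
        (fun u : Fin (k + 2) → V => τ ![u 0, u 1] * ν (fun i => u i.succ.succ)) (u ∘ π) := by
      ext u
      have e0 : π 0 = Fin.natAdd k 0 := r0
      have e1 : π 1 = Fin.natAdd k 1 := r1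
      have e2 : ∀ i : Fin k, π i.succ.succ = Fin.castAdd 2 i := r2
      simp only [Function.comp_apply, e0, e1, e2]
      rw [mul_comm]
      congr 2
      ext i
      fin_cases i <;> rfl
    have h5 : ((Equiv.Perm.sign π : ℤ) : ℝ) = 1 := by
      rw [Equiv.Perm.sign_mul, Int.units_mul_self]
      simp
    rw [wedge_apply, h4]
    refine (congrArg (fun t => ((k.factorial : ℝ) * (Nat.factorial 2 : ℝ))⁻¹ * t)
      (altSum_comp_perm (fun u : Fin (k + 2) → V =>
        τ ![u 0, u 1] * ν (fun i => u i.succ.succ)) π v)).trans ?_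
    rw [h5, one_mul, h2]
    simp only [ContinuousAlternatingMap.smul_apply, ContinuousAlternatingMap.sum_apply,
      covectorWedge_apply, Finset.mul_sum, smul_eq_mul]
    refine Finset.sum_congr rfl fun a _ => Finset.sum_congr rfl fun i _ =>
      Finset.sum_congr rfl fun j _ => ?_
    have hk : (k.factorial : ℝ) ≠ 0 := by positivity
    simp only [Nat.factorial_two]
    push_cast
    field_simp
  rw [h3, lefschetz_apply, single_smul, single_sum]
  simp only [ext_single]

end Wedge

/-! ### Contraction by the multivector of a form. -/

section Contract

variable {V : Type*} [NormedAddCommGroup V] [NormedSpace ℝ V]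

theorem interiorVectors_add {l : ℕ} : ∀ (k : ℕ) (v : Fin k → V) (μ ν : V [⋀^Fin (l + k)]→L[ℝ] ℝ),
    interiorVectors k v (μ + ν) = interiorVectors k v μ + interiorVectors k v ν
  | 0, _, _, _ => rfl
  | k + 1, v, μ, ν => by
    rw [interiorVectors, interiorVectors, interiorVectors, ← interiorVectors_add k]
    rfl

theorem interiorVectors_smul {l : ℕ} : ∀ (k : ℕ) (v : Fin k → V) (c : ℝ)
    (μ : V [⋀^Fin (l + k)]→L[ℝ] ℝ),
    interiorVectors k v (c • μ) = c • interiorVectors k v μ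
  | 0, _, _, _ => rfl
  | k + 1, v, c, μ => by
    rw [interiorVectors, interiorVectors, ← interiorVectors_smul k]
    rfl

/-- Contraction by a list of vectors, as a linear map. -/
def interiorVectorsₗ (l k : ℕ) (v : Fin k → V) :
    (V [⋀^Fin (l + k)]→L[ℝ] ℝ) →ₗ[ℝ] V [⋀^Fin l]→L[ℝ] ℝ where
  toFun := interiorVectors k v
  map_add' := interiorVectors_add k v
  map_smul' := interiorVectors_smul k v

/-- Bringing the vector in place `i` to the front passes `i` others, one sign each. -/
theorem interiorVectors_removeNth {l : ℕ} : ∀ (k : ℕ) (v : Fin (k + 1) → V) (i : Fin (k + 1))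
    (μ : V [⋀^Fin (l + k + 1)]→L[ℝ] ℝ),
    interiorVectors (l := l) k (fun j => v j.succ) (interior (v 0) μ)
      = (-1 : ℝ) ^ (i : ℕ) • interiorVectors (l := l) k (i.removeNth v) (interior (v i) μ) := by
  intro k
  induction k with
  | zero =>
    intro v i μ
    obtain rfl : i = 0 := Fin.fin_one_eq_zero i
    simp [interiorVectors]
  | succ k ih =>
    intro v i μ
    refine Fin.cases ?_ (fun j => ?_) i
    · simp
      rfl
    · have h := ih (fun j => v j.succ) j (interior (v 0) μ)
      have h1 : interiorVectors (l := l) (k + 1) (j.succ.removeNth v) (interior (v j.succ) μ)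
          = -interiorVectors (l := l) k (j.removeNth (fun j => v j.succ))
            (interior (v j.succ) (interior (v 0) μ)) := by
        rw [interiorVectors]
        have h2 : (fun i : Fin k => j.succ.removeNth v i.succ)
            = j.removeNth (fun j => v j.succ) := by
          ext i
          simp [Fin.removeNth]
        have h3 : j.succ.removeNth v 0 = v 0 := by simp [Fin.removeNth]
        rw [h2, h3]
        refine Eq.trans ?_ (map_neg (interiorVectorsₗ l k _) _)
        exact congrArg (interiorVectors k _) (interior_anticomm (k := l + k) _ _ _)
      rw [h1, interiorVectors]
      refine h.trans ?_
      rw [Fin.val_succ, pow_succ]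
      simp

variable [FiniteDimensional ℝ V]

variable {Ω : V [⋀^Fin 2]→L[ℝ] ℝ} (h : Nondegenerate Ω)

theorem apply_sharpTranspose (φ χ : Module.Dual ℝ V) :
    χ (sharpTranspose Ω h φ) = φ (sharp Ω h χ) := by
  change χ ((Module.evalEquiv ℝ V).symm _) = _
  rw [Module.apply_evalEquiv_symm_apply]
  rfl

theorem sharpTranspose_eq (φ : Module.Dual ℝ V) : sharpTranspose Ω h φ = -sharp Ω h φ := by
  rw [← sub_eq_zero, ← Module.forall_dual_apply_eq_zero_iff ℝ]
  intro χ
  rw [map_sub, map_neg, apply_sharpTranspose, apply_sharp]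
  simp

/-- The transpose of `♯` is `-♯`, and in degree 2 the two signs cancel. -/
theorem inverseBivector_eq : inverseBivector Ω h = sharpForm Ω h Ω := by
  ext φ
  have h1 : (fun i => sharpTranspose Ω h (φ i)) = fun i => (-1 : ℝ) • sharp Ω h (φ i) := by
    ext i
    rw [sharpTranspose_eq, neg_one_smul]
  change Ω (fun i => sharp Ω h (φ i)) = Ω (fun i => sharpTranspose Ω h (φ i))
  rw [h1, ContinuousAlternatingMap.map_smul_univ]
  simp

variable (Ω) in
/-- Contraction of families of forms by the multivector `♯_Ω ν`. -/
def contractOp (h : Nondegenerate Ω) {k : ℕ} (ν : V [⋀^Fin k]→L[ℝ] ℝ) :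
    Module.End ℝ (Forms V) where
  toFun F l := contract (sharpForm Ω h ν) (F (l + k))
  map_add' F G := by
    ext l : 1
    simp [contract, interiorVectors_add, Finset.sum_add_distrib]
  map_smul' c F := by
    ext l : 1
    simp only [contract, Pi.smul_apply, interiorVectors_smul, RingHom.id_apply]
    rw [smul_comm c, Finset.smul_sum (r := c)]
    simp only [smul_comm c]

theorem contractOp_apply {k : ℕ} (ν : V [⋀^Fin k]→L[ℝ] ℝ) (F : Forms V) (l : ℕ) :
    contractOp Ω h ν F l = contract (sharpForm Ω h ν) (F (l + k)) := rfl

theorem contractOp_add {k : ℕ} (μ ν : V [⋀^Fin k]→L[ℝ] ℝ) :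
    contractOp Ω h (μ + ν) = contractOp Ω h μ + contractOp Ω h ν := by
  ext F l : 2
  simp [contractOp_apply, contract, sharpForm, add_smul, Finset.sum_add_distrib]

theorem contractOp_smul {k : ℕ} (c : ℝ) (ν : V [⋀^Fin k]→L[ℝ] ℝ) :
    contractOp Ω h (c • ν) = c • contractOp Ω h ν := by
  ext F l : 2
  simp only [contractOp_apply, contract, sharpForm, LinearMap.smul_apply, Pi.smul_apply]
  rw [smul_comm c, Finset.smul_sum (r := c)]
  simp [mul_smul]

variable (Ω) in
/-- `contractOp` as a linear map. -/
def contractOpₗ (h : Nondegenerate Ω) (k : ℕ) :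
    (V [⋀^Fin k]→L[ℝ] ℝ) →ₗ[ℝ] Module.End ℝ (Forms V) where
  toFun := contractOp Ω h
  map_add' := contractOp_add h
  map_smul' := contractOp_smul h

theorem contractOp_one : contractOp Ω h (one V) = 1 := by
  ext F l : 2
  simp [contractOp_apply, contract, sharpForm, interiorVectors, one]

/-- The components of `♯(α ∧ ν)` are signed sums over the place taken by `α`. Moving the
corresponding vector to the front cancels the sign, so all `k + 1` places contribute equally and `(k
+ 1) / (k + 1)! = 1 / k!`. -/
theorem contractOp_covectorWedge {k : ℕ} (α : Module.Dual ℝ V) (ν : V [⋀^Fin k]→L[ℝ] ℝ)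
    (F : Forms V) :
    contractOp Ω h (covectorWedge α ν) F = contractOp Ω h ν (int (sharp Ω h α) F) := by
  ext l : 1
  rw [contractOp_apply, contractOp_apply, int_apply, contract, contract]
  set b := Module.finBasis ℝ V
  have h1 : ∀ j : Fin (k + 1) → Fin (Module.finrank ℝ V),
      sharpForm Ω h (covectorWedge α ν) (fun a => b.coord (j a)) •
        interiorVectors (k + 1) (fun a => b (j a)) (F (l + (k + 1)))
      = ∑ i : Fin (k + 1), b.coord (j i) (sharp Ω h α) •
        sharpForm Ω h ν (fun a => b.coord (i.removeNth j a)) •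
        interiorVectors k (fun a => b (i.removeNth j a)) (interior (b (j i)) (F (l + k + 1))) := by
    intro j
    have h2 : sharpForm Ω h (covectorWedge α ν) (fun a => b.coord (j a))
        = ∑ i : Fin (k + 1), (-1) ^ (i : ℕ) * (b.coord (j i) (sharp Ω h α) *
          sharpForm Ω h ν (fun a => b.coord (i.removeNth j a))) := by
      refine (covectorWedge_apply α ν _).trans (Finset.sum_congr rfl fun i _ => ?_)
      congr 2
      exact apply_sharpTranspose h _ _
    rw [h2, Finset.sum_smul]
    refine Finset.sum_congr rfl fun i _ => ?_
    have h3 := interiorVectors_removeNth (l := l) k (fun a => b (j a)) i (F (l + k + 1))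
    rw [interiorVectors]
    refine (congrArg (fun t => ((-1 : ℝ) ^ (i : ℕ) * (b.coord (j i) (sharp Ω h α) *
          sharpForm Ω h ν (fun a => b.coord (i.removeNth j a)))) • t) h3).trans ?_
    simp only [smul_smul]
    congr 1
    have h4 : ((-1 : ℝ) ^ (i : ℕ)) * (-1) ^ (i : ℕ) = 1 := by
      rw [← mul_pow]
      simp
    linear_combination (b.coord (j i) (sharp Ω h α) *
          sharpForm Ω h ν (fun a => b.coord (i.removeNth j a))) * h4
  -- Summing over the index in place `i` alone rebuilds `♯α` from its coordinates, so the result is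
  -- independent of `i`.
  have h5 : ∀ i : Fin (k + 1), ∑ j : Fin (k + 1) → Fin (Module.finrank ℝ V),
      b.coord (j i) (sharp Ω h α) •
        sharpForm Ω h ν (fun a => b.coord (i.removeNth j a)) •
        interiorVectors k (fun a => b (i.removeNth j a)) (interior (b (j i)) (F (l + k + 1)))
      = ∑ j : Fin k → Fin (Module.finrank ℝ V), sharpForm Ω h ν (fun a => b.coord (j a)) •
        interiorVectors k (fun a => b (j a)) (interior (sharp Ω h α) (F (l + k + 1))) := by
    intro i
    rw [← (Fin.insertNthEquiv (fun _ => Fin (Module.finrank ℝ V)) i).sum_comp,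
      Fintype.sum_prod_type_right]
    refine Finset.sum_congr rfl fun j _ => ?_
    simp only [Fin.insertNthEquiv_apply, Fin.insertNth_apply_same]
    have h6 : interior (sharp Ω h α) (F (l + k + 1))
        = ∑ c, b.coord c (sharp Ω h α) • interior (b c) (F (l + k + 1)) := by
      have h7 := congrArg (fun v => int v F (l + k)) (sum_coord_smul b (sharp Ω h α))
      simp only [map_sum, map_smul, LinearMap.sum_apply, LinearMap.smul_apply, Finset.sum_apply,
        Pi.smul_apply, int_apply] at h7
      exact h7.symm
    rw [h6]
    change _ = _ • interiorVectorsₗ l k _ _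
    rw [map_sum, Finset.smul_sum]
    refine Finset.sum_congr rfl fun c _ => ?_
    have h8 : i.removeNth (Fin.insertNthEquiv (fun _ => Fin (Module.finrank ℝ V)) i (c, j)) = j :=
      Fin.removeNth_insertNth (α := fun _ => Fin (Module.finrank ℝ V)) i c j
    rw [map_smul, smul_comm, h8]
    rfl
  simp only [h1]
  rw [Finset.sum_comm]
  simp only [h5]
  rw [Finset.sum_const, Finset.card_univ, Fintype.card_fin, ← Nat.cast_smul_eq_nsmul ℝ, smul_smul,
    Nat.factorial_succ]
  congr 1
  push_cast
  have h8 : (k : ℝ) + 1 ≠ 0 := by positivity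
  have h9 : (k.factorial : ℝ) ≠ 0 := by positivity
  field_simp

theorem lefschetz_single_apply (τ : V [⋀^Fin 2]→L[ℝ] ℝ) (F : Forms V) (k : ℕ) :
    lefschetz τ F (k + 2) = (2⁻¹ : ℝ) • ∑ a, covectorWedge ((Module.finBasis ℝ V).coord a)
      (covectorWedge (flat τ (Module.finBasis ℝ V a)) (F k)) := by
  rw [lefschetz_apply, Pi.smul_apply, Finset.sum_apply]
  rfl

/-- `♯` turns the factors `e^a` and `♭e_a` of `L` into `♯e^a` and `e_a`, which are the contractions
in `Λ`. -/
theorem contractOp_lefschetz (F G : Forms V) (k : ℕ) :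
    contractOp Ω h (lefschetz Ω F (k + 2)) G = contractOp Ω h (F k) (dualLefschetz Ω h G) := by
  rw [lefschetz_single_apply, dualLefschetz_apply, map_smul, map_sum]
  change contractOpₗ Ω h (k + 2) _ G = _
  rw [map_smul, map_sum, LinearMap.smul_apply, LinearMap.sum_apply]
  congr 1
  refine Finset.sum_congr rfl fun a _ => ?_
  change contractOp Ω h _ G = _
  rw [contractOp_covectorWedge, contractOp_covectorWedge, sharp_flat]

theorem contractOp_self : contractOp Ω h Ω = dualLefschetz Ω h := by
  refine LinearMap.ext fun G => ?_
  have h1 := contractOp_lefschetz h (single (one V)) G 0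
  rw [lefschetz_one, single_same, single_same, contractOp_one] at h1
  exact h1

theorem single_lefschetzDual {l : ℕ} (ν : V [⋀^Fin (l + 2)]→L[ℝ] ℝ) :
    lefschetzDual Ω h ν = dualLefschetz Ω h (single ν) l := by
  rw [← contractOp_self, contractOp_apply, single_same, lefschetzDual, inverseBivector_eq]

theorem lefschetzDual_eq_sum {l : ℕ} (ν : V [⋀^Fin (l + 2)]→L[ℝ] ℝ) :
    lefschetzDual Ω h ν = (2⁻¹ : ℝ) • ∑ a, interior (Module.finBasis ℝ V a)
      (interior (sharp Ω h ((Module.finBasis ℝ V).coord a)) ν) := by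
  rw [single_lefschetzDual, dualLefschetz_apply, Pi.smul_apply, Finset.sum_apply]
  simp only [int_apply, single_same]

end Contract

/-! ### The star operator and primitive 3-forms. -/

section Star

variable {V : Type*} [NormedAddCommGroup V] [NormedSpace ℝ V]

theorem int_one (v : V) : int v (single (one V)) = 0 := int_single_zero v _

variable [FiniteDimensional ℝ V] {Ω : V [⋀^Fin 2]→L[ℝ] ℝ} (h : Nondegenerate Ω)

theorem dualLefschetz_one : dualLefschetz Ω h (single (one V)) = 0 := by
  rw [dualLefschetz_apply]
  simp [int_one]

theorem dualLefschetz_single {l : ℕ} (ν : V [⋀^Fin (l + 2)]→L[ℝ] ℝ) :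
    dualLefschetz Ω h (single ν) = single (lefschetzDual Ω h ν) := by
  rw [dualLefschetz_apply, lefschetzDual_eq_sum, single_smul, single_sum]
  simp only [int_single_succ]

theorem dualLefschetz_int (v : V) (F : Forms V) :
    dualLefschetz Ω h (int v F) = int v (dualLefschetz Ω h F) := by
  simp only [dualLefschetz_apply, map_smul, map_sum]
  congr 1
  refine Finset.sum_congr rfl fun a _ => ?_
  rw [int_int _ v, map_neg, int_int _ v, neg_neg]

theorem single_wedgePow (Ω : V [⋀^Fin 2]→L[ℝ] ℝ) (j : ℕ) :
    single (wedgePow Ω j) = (lefschetz Ω ^ j) (single (one V)) := by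
  induction j with
  | zero => rfl
  | succ j ih =>
    rw [pow_succ', Module.End.mul_apply, ← ih]
    exact single_wedge_two _ _

theorem dualLefschetz_lefschetz_single {n : ℕ} (hn : Module.finrank ℝ V = 2 * n) {k : ℕ}
    (ν : V [⋀^Fin k]→L[ℝ] ℝ) :
    dualLefschetz Ω h (lefschetz Ω (single ν))
      = lefschetz Ω (dualLefschetz Ω h (single ν)) + ((n : ℝ) - k) • single ν := by
  ext l : 1
  rw [dualLefschetz_lefschetz h hn, Pi.add_apply, Pi.smul_apply]
  rcases eq_or_ne l k with rfl | hl
  · rfl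
  · rw [single_of_ne hl, smul_zero, smul_zero]

/-- The induction adds the weight of `Ω^(j+1)`: `(j+1)(n-j) + (n - 2(j+1)) = (j+2)(n-j-1)`. -/
theorem dualLefschetz_lefschetz_pow {n : ℕ} (hn : Module.finrank ℝ V = 2 * n) (j : ℕ) :
    dualLefschetz Ω h ((lefschetz Ω ^ (j + 1)) (single (one V)))
      = (((j : ℝ) + 1) * (n - j)) • (lefschetz Ω ^ j) (single (one V)) := by
  induction j with
  | zero =>
    rw [zero_add, pow_one, pow_zero, dualLefschetz_lefschetz_single h hn, dualLefschetz_one]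
    simp
  | succ j ih =>
    rw [pow_succ' _ (j + 1), Module.End.mul_apply, ← single_wedgePow,
      dualLefschetz_lefschetz_single h hn, single_wedgePow, ih, map_smul, ← Module.End.mul_apply,
      ← pow_succ', ← add_smul]
    congr 1
    push_cast
    ring

/-- With `n = m + 2`, passing from `j` to `j + 1` brings the factor `(j+3)(m-j)`. The factor
`(m-j)!` on the left keeps the induction free of division; the case used is `j = m`. -/
theorem dualLefschetz_pow_lefschetz_pow {m : ℕ} (hn : Module.finrank ℝ V = 2 * (m + 2)) (j : ℕ)
    (hj : j ≤ m) :
    ((m - j).factorial : ℝ) • (dualLefschetz Ω h ^ j)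
        ((lefschetz Ω ^ (j + 2)) (single (one V)))
      = (((j + 2).factorial : ℝ) * m.factorial * 2⁻¹) • (lefschetz Ω ^ 2) (single (one V)) := by
  induction j with
  | zero =>
    rw [Nat.sub_zero, zero_add, pow_zero, Module.End.one_apply, Nat.factorial_two]
    congr 1
    push_cast
    ring
  | succ j ih =>
    have ih := ih (by omega)
    rw [pow_succ _ j, Module.End.mul_apply, dualLefschetz_lefschetz_pow h hn (j + 2 : ℕ), map_smul,
      smul_smul]
    have h1 : ((m - j).factorial : ℝ) = ((m : ℝ) - j) * ((m - (j + 1)).factorial : ℝ) := by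
      obtain ⟨r, rfl⟩ := Nat.exists_eq_add_of_le hj
      rw [show j + 1 + r - j = r + 1 by omega, show j + 1 + r - (j + 1) = r by omega,
        Nat.factorial_succ]
      push_cast
      ring
    have h2 : ((j + 1 + 2).factorial : ℝ) = ((j : ℝ) + 3) * ((j + 2).factorial : ℝ) := by
      rw [Nat.factorial_succ]
      push_cast
      ring
    rw [h2]
    calc _ = ((j : ℝ) + 3) • (((m - j).factorial : ℝ) • (dualLefschetz Ω h ^ j)
        ((lefschetz Ω ^ (j + 2)) (single (one V)))) := by
          rw [smul_smul, h1]
          congr 1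
          push_cast
          ring
      _ = _ := by
        rw [ih, smul_smul]
        congr 1
        ring

theorem star_eq {n k l : ℕ} (hkl : 2 * n = l + k) (ν : V [⋀^Fin k]→L[ℝ] ℝ) :
    star Ω h hkl ν
      = ((n.factorial : ℝ)⁻¹) • contractOp Ω h ν ((lefschetz Ω ^ n) (single (one V))) l := by
  rw [← Pi.smul_apply, ← map_smul, contractOp_apply, Pi.smul_apply, ← single_wedgePow,
    ← single_castDegree hkl]
  rfl

theorem star_self {m : ℕ} (hn : Module.finrank ℝ V = 2 * (m + 2))
    (hkl : 2 * (m + 2) = 2 * (m + 1) + 2) :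
    star Ω h hkl Ω = (((m + 1).factorial : ℝ)⁻¹) • wedgePow Ω (m + 1) := by
  rw [star_eq, contractOp_self, dualLefschetz_lefschetz_pow h hn (m + 1), ← single_wedgePow,
    Pi.smul_apply, single_same, smul_smul]
  congr 1
  rw [Nat.factorial_succ (m + 1)]
  push_cast
  have h1 : ((m + 1).factorial : ℝ) ≠ 0 := by positivity
  field_simp
  ring

theorem contractOp_lefschetz_pow (F G : Forms V) (m : ℕ) :
    contractOp Ω h ((lefschetz Ω ^ m) F (2 * m + 3)) G
      = contractOp Ω h (F 3) ((dualLefschetz Ω h ^ m) G) := by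
  induction m generalizing G with
  | zero => rfl
  | succ m ih =>
    rw [pow_succ', Module.End.mul_apply, pow_succ _ m, Module.End.mul_apply, ← ih]
    exact contractOp_lefschetz h _ _ _

theorem covectorWedge_add {k : ℕ} (α : Module.Dual ℝ V) (μ ν : V [⋀^Fin k]→L[ℝ] ℝ) :
    covectorWedge α (μ + ν) = covectorWedge α μ + covectorWedge α ν := by
  have := map_add (ext α) (single μ) (single ν)
  rw [← single_add, ext_single, ext_single, ext_single, ← single_add] at this
  exact single_injective this

theorem covectorWedge_smul {k : ℕ} (α : Module.Dual ℝ V) (c : ℝ) (ν : V [⋀^Fin k]→L[ℝ] ℝ) :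
    covectorWedge α (c • ν) = c • covectorWedge α ν := by
  have := map_smul (ext α) c (single ν)
  rw [← single_smul, ext_single, ext_single, ← single_smul] at this
  exact single_injective this

/-- Left exterior multiplication by a covector, as a linear map on forms of a given degree. -/
def covectorWedgeₗ (k : ℕ) (α : Module.Dual ℝ V) :
    (V [⋀^Fin k]→L[ℝ] ℝ) →ₗ[ℝ] V [⋀^Fin (k + 1)]→L[ℝ] ℝ where
  toFun := covectorWedge α
  map_add' := covectorWedge_add α
  map_smul' := covectorWedge_smul α

/-- By the degree operator, products `α ∧ ν` span the forms of positive degree. -/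
theorem form_hom_ext {k : ℕ} {X : Type*} [AddCommGroup X] [Module ℝ X]
    (f g : (V [⋀^Fin (k + 1)]→L[ℝ] ℝ) →ₗ[ℝ] X)
    (hfg : ∀ α, f ∘ₗ covectorWedgeₗ k α = g ∘ₗ covectorWedgeₗ k α) : f = g := by
  refine LinearMap.ext fun ν => ?_
  have h1 := sum_covectorWedge_interior (Module.finBasis ℝ V) ν
  have h2 : ν = ((k : ℝ) + 1)⁻¹ • ∑ a, covectorWedge ((Module.finBasis ℝ V).coord a)
      (interior (Module.finBasis ℝ V a) ν) := by
    have h3 : ((k : ℝ) + 1)⁻¹ * ((k : ℝ) + 1) = 1 := inv_mul_cancel₀ (by positivity)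
    rw [h1, smul_smul, h3, one_smul]
  rw [h2, map_smul, map_smul, map_sum, map_sum]
  congr 1
  exact Finset.sum_congr rfl fun a _ => LinearMap.congr_fun (hfg _) _

/-- It suffices to take `γ` a product of three covectors. Since `i(♯α)Ω = α`, three contractions of
`Ω²` and the operator `Λ` on `γ` both reduce to the same combination of pairings. -/
theorem contractOp_three (γ : V [⋀^Fin 3]→L[ℝ] ℝ) :
    contractOp Ω h γ ((lefschetz Ω ^ 2) (single (one V)))
      = (2 : ℝ) • dualLefschetz Ω h (single γ) := by
  let f : (V [⋀^Fin 3]→L[ℝ] ℝ) →ₗ[ℝ] Forms V :=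
    LinearMap.applyₗ ((lefschetz Ω ^ 2) (single (one V))) ∘ₗ contractOpₗ Ω h 3
  let g : (V [⋀^Fin 3]→L[ℝ] ℝ) →ₗ[ℝ] Forms V :=
    (2 : ℝ) • (dualLefschetz Ω h ∘ₗ LinearMap.single ℝ (fun k : ℕ => V [⋀^Fin k]→L[ℝ] ℝ) 3)
  suffices hfg : f = g from LinearMap.congr_fun hfg γ
  refine form_hom_ext _ _ fun α => form_hom_ext _ _ fun β => LinearMap.ext fun ν => ?_
  change contractOp Ω h (covectorWedge α (covectorWedge β ν)) _
    = (2 : ℝ) • dualLefschetz Ω h (single (covectorWedge α (covectorWedge β ν)))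
  rw [oneForm_covector ν]
  simp only [contractOp_covectorWedge, contractOp_one, Module.End.one_apply, ← ext_single,
    pow_two, Module.End.mul_apply, int_lefschetz, flat_sharp, int_one, map_zero, map_add,
    add_zero, lefschetz_ext, int_ext, map_sub, map_smul, sub_zero,
    dualLefschetz_ext, dualLefschetz_one, zero_sub, map_neg]
  -- Antisymmetry puts each pairing of two covectors in one order, so that both sides have the same
  -- scalars.
  rw [apply_sharp h β α, apply_sharp h (covector ν) α, apply_sharp h (covector ν) β]
  module

/-- Contraction of `Ω^n` by `♯(Ω^m ∧ γ)` is contraction of `Λ^m Ω^n` by `♯γ`; with `n = m + 2` the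
latter form is `(n! m! / 2) Ω²`, and `contractOp_three` finishes. -/
theorem star_lefschetz_pow {m : ℕ} (hn : Module.finrank ℝ V = 2 * (m + 2))
    (hkl : 2 * (m + 2) = 1 + (2 * (m + 1) + 1)) (γ : V [⋀^Fin 3]→L[ℝ] ℝ) :
    star Ω h hkl (k := 2 * (m + 1) + 1) ((lefschetz Ω ^ m) (single γ) (2 * m + 3))
      = (m.factorial : ℝ) • lefschetzDual Ω h γ := by
  have h1 := dualLefschetz_pow_lefschetz_pow h hn m le_rfl
  rw [Nat.sub_self, Nat.factorial_zero, Nat.cast_one, one_smul] at h1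
  have h2 := contractOp_lefschetz_pow h (single γ) ((lefschetz Ω ^ (m + 2)) (single (one V))) m
  rw [h1, map_smul, single_same, contractOp_three, smul_smul, dualLefschetz_single] at h2
  rw [star_eq]
  refine (congrArg (fun F : Forms V => (((m + 2).factorial : ℝ)⁻¹) • F 1) h2).trans ?_
  rw [Pi.smul_apply, single_same, smul_smul]
  congr 1
  have h3 : ((m + 2).factorial : ℝ) ≠ 0 := by positivity
  field_simp

theorem lefschetzDual_wedge_one {n : ℕ} (hn : Module.finrank ℝ V = 2 * n)
    (α : V [⋀^Fin 1]→L[ℝ] ℝ) :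
    lefschetzDual Ω h (l := 1) (wedge α Ω) = ((n : ℝ) - 1) • α := by
  rw [single_lefschetzDual]
  have h1 := single_wedge_one_two α Ω
  have h2 : single α = ext (covector α) (single (one V)) := by
    rw [ext_single, ← oneForm_covector]
  refine (congrArg (fun F => dualLefschetz Ω h F 1) h1).trans ?_
  rw [← lefschetz_one Ω, ← lefschetz_ext, ← h2, dualLefschetz_lefschetz_single h hn, h2,
    dualLefschetz_ext, int_one, dualLefschetz_one, ← h2]
  simp

theorem form_eq_zero_of_finrank_lt {k : ℕ} (hk : Module.finrank ℝ V < k)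
    (ν : V [⋀^Fin k]→L[ℝ] ℝ) : ν = 0 := by
  ext v
  refine ν.toAlternatingMap.map_linearDependent v fun hv => ?_
  have := hv.fintype_card_le_finrank
  rw [Fintype.card_fin] at this
  omega

/-- The commutator has weight `2 - 3 = -1` on `ψ`, while `Lψ` is a 5-form in dimension 4 and `Λψ =
0`. -/
theorem three_form_eq_zero (hn : Module.finrank ℝ V = 2 * 2) (ψ : V [⋀^Fin 3]→L[ℝ] ℝ)
    (hψ : lefschetzDual Ω h (l := 1) ψ = 0) : ψ = 0 := by
  have h1 := dualLefschetz_lefschetz_single h hn ψ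
  rw [dualLefschetz_single (l := 1) h ψ, hψ, ← single_wedge_two,
    form_eq_zero_of_finrank_lt (by omega) (wedge ψ Ω), single_zero, single_zero, map_zero, map_zero,
    zero_add, ← single_smul] at h1
  have h2 := single_injective (single_zero.trans h1)
  have h3 : ((2 : ℕ) : ℝ) - (3 : ℕ) = -1 := by norm_num
  rw [h3] at h2
  exact (smul_eq_zero.1 h2.symm).resolve_left (by norm_num)

omit [FiniteDimensional ℝ V] in
theorem interior_oneForm_eq_zero_iff (X : V) (α : V [⋀^Fin 1]→L[ℝ] ℝ) :
    interior X α = 0 ↔ covector α X = 0 := by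
  constructor
  · intro h0
    have h1 := congrArg (fun ν => ν ![]) h0
    rw [interior_apply] at h1
    change α (fun _ => X) = 0
    refine Eq.trans ?_ h1
    congr 1
    ext i
    fin_cases i
    rfl
  · intro h0
    ext v
    rw [interior_apply]
    change α (fun _ => X) = 0 at h0
    refine Eq.trans ?_ h0
    congr 1
    ext i
    fin_cases i
    rfl

theorem interior_eq_zero_iff {n : ℕ} (hn2 : 2 ≤ n) (hn : Module.finrank ℝ V = 2 * n) (X : V)
    (α : V [⋀^Fin 1]→L[ℝ] ℝ) (γ ψ : V [⋀^Fin 3]→L[ℝ] ℝ)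
    (hγ : γ = wedge α Ω + ψ) (hψ : lefschetzDual Ω h (l := 1) ψ = 0) :
    interior X γ = 0 ↔ interior X α = 0 ∧ wedge α (interior X Ω) - interior X ψ = 0 := by
  have h1 : single (interior X γ) = covector α X • single Ω
      - single (k := 2) (wedge α (interior X Ω) - interior X ψ) := by
    have h2 : single γ = ext (covector α) (single Ω) + single ψ := by
      rw [hγ, single_add]
      congr 1
      exact single_wedge_one_two α Ω
    have h3 : single (k := 2) (wedge α (interior X Ω)) = ext (covector α) (int X (single Ω)) :=
      (single_wedge_one_one α (interior X Ω)).trans (by rw [int_single_succ])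
    rw [single_sub, h3, ← int_single_succ, ← int_single_succ, h2, map_add, int_ext]
    abel
  rw [interior_oneForm_eq_zero_iff]
  constructor
  · intro h0
    -- `Λ` is applied to `i(X)ψ = -i(X)(α ∧ Ω)`. The left side vanishes since `Λ` commutes with
    -- `i(X)`; on the right `ΛΩ = n` and `Λ(α ∧ i(X)Ω) = α(X)`, which leaves `(n - 1)α(X) = 0`.
    have h2 : covector α X = 0 := by
      have h3 : single ψ = single γ - ext (covector α) (single Ω) := by
        rw [hγ, single_add, eq_sub_iff_add_eq, add_comm]
        congr 1
        exact (single_wedge_one_two α Ω).symm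
      have h4 : dualLefschetz Ω h (int X (single ψ)) = 0 := by
        rw [dualLefschetz_int, dualLefschetz_single (l := 1) h ψ, hψ, single_zero, map_zero]
      rw [h3, map_sub, int_single_succ, h0, single_zero, zero_sub, int_ext, int_single_succ,
        interior_two_form, ← lefschetz_one Ω, ← ext_single, map_neg, map_sub, map_smul,
        dualLefschetz_lefschetz_single h hn, dualLefschetz_ext, dualLefschetz_ext, int_ext,
        dualLefschetz_one, int_one, int_one, flat_antisymm, flat_sharp] at h4
      simp only [map_zero, sub_zero, zero_add, Nat.cast_zero, smul_smul, zero_sub,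
        neg_eq_zero] at h4
      have h5 : (covector α X * n - covector α X) • one V = 0 := by
        apply single_injective
        rw [single_zero, ← h4, single_smul]
        module
      have h6 := congrArg (fun ν => ν ![]) h5
      simp [one] at h6
      have h7 : covector α X * ((n : ℝ) - 1) = 0 := by linarith
      have h8 : (2 : ℝ) ≤ n := by exact_mod_cast hn2
      rcases mul_eq_zero.1 h7 with h9 | h9
      · exact h9
      · linarith
    refine ⟨h2, ?_⟩
    rw [h0, h2, zero_smul, zero_sub, single_zero, eq_comm, neg_eq_zero] at h1
    exact single_injective (h1.trans single_zero.symm)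
  · rintro ⟨h2, h3⟩
    rw [h2, zero_smul] at h1
    refine single_injective (h1.trans ?_)
    refine Eq.trans ?_ single_zero.symm
    rw [zero_sub, neg_eq_zero]
    exact (congrArg (single (k := 2)) h3).trans single_zero

end Star

/-! ### Naturality, smoothness and differentiation on the model space. -/

section Calculus

variable {E : Type*} [NormedAddCommGroup E] [NormedSpace ℝ E]

theorem interior_pullback {F : Type*} [NormedAddCommGroup F] [NormedSpace ℝ F] {k : ℕ}
    (A : E →L[ℝ] F) (ν : F [⋀^Fin (k + 1)]→L[ℝ] ℝ) (v : E) :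
    interior v (ν.compContinuousLinearMap A)
      = (interior (A v) ν).compContinuousLinearMap A :=
  ContinuousAlternatingMap.curryLeft_compContinuousLinearMap ν A v

theorem wedge_pullback {F : Type*} [NormedAddCommGroup F] [NormedSpace ℝ F] {k l : ℕ}
    (A : E →L[ℝ] F) (μ : F [⋀^Fin k]→L[ℝ] ℝ) (ν : F [⋀^Fin l]→L[ℝ] ℝ) :
    wedge (μ.compContinuousLinearMap A) (ν.compContinuousLinearMap A)
      = (wedge μ ν).compContinuousLinearMap A := by
  ext v
  rw [wedge_apply, ContinuousAlternatingMap.compContinuousLinearMap_apply, wedge_apply]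
  rfl

theorem wedgePow_pullback {F : Type*} [NormedAddCommGroup F] [NormedSpace ℝ F]
    (A : E →L[ℝ] F) (Ω : F [⋀^Fin 2]→L[ℝ] ℝ) (m : ℕ) :
    wedgePow (Ω.compContinuousLinearMap A) m
      = (wedgePow Ω m).compContinuousLinearMap A := by
  induction m with
  | zero => rfl
  | succ m ih => rw [wedgePow, wedgePow, ih, wedge_pullback]

theorem nondegenerate_pullback {F : Type*} [NormedAddCommGroup F] [NormedSpace ℝ F]
    (A : E ≃L[ℝ] F) {Ω : F [⋀^Fin 2]→L[ℝ] ℝ} (h : Nondegenerate Ω) :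
    Nondegenerate (Ω.compContinuousLinearMap (A : E →L[ℝ] F)) := by
  intro v hv
  rw [interior_pullback] at hv
  have h1 : A v = 0 := by
    refine h _ ?_
    ext w
    have h2 := congrArg (fun ν => ν (fun i => A.symm (w i))) hv
    simpa [Function.comp_def] using h2
  simpa using h1

variable [FiniteDimensional ℝ E]

instance finiteDimensional_form (k : ℕ) : FiniteDimensional ℝ (E [⋀^Fin k]→L[ℝ] ℝ) := by
  let f : (E [⋀^Fin k]→L[ℝ] ℝ) →ₗ[ℝ] MultilinearMap ℝ (fun _ : Fin k => E) ℝ :=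
    { toFun := fun ν => ν.toAlternatingMap.toMultilinearMap
      map_add' := fun _ _ => rfl
      map_smul' := fun _ _ => rfl }
  refine Module.Finite.of_injective f fun μ ν hμν => ?_
  ext v
  exact congrArg (fun g => g v) hμν

theorem sharp_pullback {F : Type*} [NormedAddCommGroup F] [NormedSpace ℝ F]
    [FiniteDimensional ℝ F] (A : E ≃L[ℝ] F) {Ω : F [⋀^Fin 2]→L[ℝ] ℝ} (h : Nondegenerate Ω)
    (φ : Module.Dual ℝ F) :
    A (sharp _ (nondegenerate_pullback A h) (φ ∘ₗ (A : E →ₗ[ℝ] F))) = sharp Ω h φ := by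
  apply flat_injective h
  rw [flat_sharp]
  ext w
  have h1 := LinearMap.congr_fun
    (flat_sharp (nondegenerate_pullback A h) (φ ∘ₗ (A : E →ₗ[ℝ] F))) (A.symm w)
  rw [flat_apply] at h1 ⊢
  have h2 : φ w = (φ ∘ₗ (A : E →ₗ[ℝ] F)) (A.symm w) := by simp
  rw [h2, ← h1, ContinuousAlternatingMap.compContinuousLinearMap_apply]
  congr 1
  ext i
  fin_cases i <;> simp

/-- `A` carries the chosen basis of `E` to a basis of `F` other than the chosen one, so the point is
that `Λ` does not depend on the basis (`sum_basis_coord_eq`). -/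
theorem lefschetzDual_pullback {F : Type*} [NormedAddCommGroup F] [NormedSpace ℝ F]
    [FiniteDimensional ℝ F] (A : E ≃L[ℝ] F) {Ω : F [⋀^Fin 2]→L[ℝ] ℝ} (h : Nondegenerate Ω)
    {l : ℕ} (ν : F [⋀^Fin (l + 2)]→L[ℝ] ℝ) :
    lefschetzDual _ (nondegenerate_pullback A h) (ν.compContinuousLinearMap (A : E →L[ℝ] F))
      = (lefschetzDual Ω h ν).compContinuousLinearMap (A : E →L[ℝ] F) := by
  let B : F →ₗ[ℝ] Module.Dual ℝ F →ₗ[ℝ] F [⋀^Fin l]→L[ℝ] ℝ :=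
    LinearMap.mk₂ ℝ (fun v φ => int v (int (sharp Ω h φ) (single ν)) l)
      (by simp) (by simp) (by simp) (by simp)
  have h1 := sum_basis_coord_eq (Module.finBasis ℝ F)
    ((Module.finBasis ℝ E).map A.toLinearEquiv) B
  have h2 : ∀ v φ, B v φ = interior v (interior (sharp Ω h φ) ν) := fun v φ => by
    change int v (int (sharp Ω h φ) (single ν)) l = _
    rw [int_apply, int_apply, single_same]
  simp only [h2] at h1
  rw [lefschetzDual_eq_sum, lefschetzDual_eq_sum, h1]
  ext w
  simp only [ContinuousAlternatingMap.smul_apply, ContinuousAlternatingMap.sum_apply,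
    ContinuousAlternatingMap.compContinuousLinearMap_apply]
  congr 1
  refine Finset.sum_congr rfl fun a _ => ?_
  rw [interior_pullback, interior_pullback]
  have h3 : (Module.finBasis ℝ E).coord a
      = (((Module.finBasis ℝ E).map A.toLinearEquiv).coord a) ∘ₗ (A : E →ₗ[ℝ] F) := by
    ext v
    simp
  rw [h3]
  have h4 := sharp_pullback A h (((Module.finBasis ℝ E).map A.toLinearEquiv).coord a)
  rw [ContinuousLinearEquiv.coe_coe, h4]
  rfl

/-- `flat` with values in continuous linear maps, as a continuous bilinear map. -/
def flatₗ : (E [⋀^Fin 2]→L[ℝ] ℝ) →L[ℝ] E →L[ℝ] E →L[ℝ] ℝ :=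
  LinearMap.toContinuousBilinearMap (LinearMap.mk₂ ℝ
    (fun τ v => LinearMap.toContinuousLinearMap (flat τ v))
    (fun τ τ' v => by
      ext w
      simp [flat_apply])
    (fun c τ v => by
      ext w
      simp [flat_apply])
    (fun τ v w => by
      ext w
      simp)
    (fun c τ v => by
      ext w
      simp))

/-- The total function `inverse` requires no proof of non-degeneracy, so `♯` can be differentiated
as the 2-form varies. -/
theorem sharp_eq_inverse {Ω : E [⋀^Fin 2]→L[ℝ] ℝ} (h : Nondegenerate Ω) :
    ∃ e : E ≃L[ℝ] (E →L[ℝ] ℝ), (e : E →L[ℝ] E →L[ℝ] ℝ) = flatₗ Ω ∧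
      ∀ φ : E →L[ℝ] ℝ, sharp Ω h φ = (flatₗ Ω).inverse φ := by
  let e : E ≃L[ℝ] (E →L[ℝ] ℝ) :=
    ((sharp Ω h).symm.trans (LinearMap.toContinuousLinearMap (𝕜 := ℝ) (E := E)
      (F' := ℝ))).toContinuousLinearEquiv
  have he : (e : E →L[ℝ] E →L[ℝ] ℝ) = flatₗ Ω := rfl
  refine ⟨e, he, fun φ => ?_⟩
  rw [← he, ContinuousLinearMap.inverse_equiv]
  rfl

theorem contDiffAt_inverse_flatₗ {Ω : E [⋀^Fin 2]→L[ℝ] ℝ} (h : Nondegenerate Ω) :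
    ContDiffAt ℝ ∞ (fun τ : E [⋀^Fin 2]→L[ℝ] ℝ => (flatₗ τ).inverse) Ω := by
  obtain ⟨e, he, -⟩ := sharp_eq_inverse h
  have h1 : ContDiffAt ℝ ∞ ContinuousLinearMap.inverse (flatₗ Ω) := by
    rw [← he]
    exact contDiffAt_map_inverse e
  have h2 : ContDiffAt ℝ ∞ (fun τ : E [⋀^Fin 2]→L[ℝ] ℝ => flatₗ τ) Ω := by
    fun_prop
  exact h1.comp Ω h2

/-- Contraction as a bilinear map. -/
def interiorₗ (k : ℕ) : E →ₗ[ℝ] (E [⋀^Fin (k + 1)]→L[ℝ] ℝ) →ₗ[ℝ] E [⋀^Fin k]→L[ℝ] ℝ :=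
  LinearMap.mk₂ ℝ interior (fun v w ν => by simp [interior]) (fun c v ν => by simp [interior])
    (fun v μ ν => by simp [interior]) (fun c v ν => by simp [interior])

theorem contDiffWithinAt_interior {G : Type*} [NormedAddCommGroup G] [NormedSpace ℝ G] {k : ℕ}
    {X : G → E} {ν : G → E [⋀^Fin (k + 1)]→L[ℝ] ℝ} {s : Set G} {y : G}
    (hX : ContDiffWithinAt ℝ ∞ X s y) (hν : ContDiffWithinAt ℝ ∞ ν s y) :
    ContDiffWithinAt ℝ ∞ (fun z => interior (X z) (ν z)) s y := by
  have := ((LinearMap.toContinuousBilinearMap (interiorₗ (E := E) k)).isBoundedBilinearMap.contDiff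
    (n := ∞)).contDiffAt (x := (X y, ν y))
  exact this.comp_contDiffWithinAt y (hX.prodMk hν)

theorem contDiffWithinAt_sharp {G : Type*} [NormedAddCommGroup G] [NormedSpace ℝ G]
    {W : G → E [⋀^Fin 2]→L[ℝ] ℝ} {φ : G → E →L[ℝ] ℝ} {s : Set G} {y : G}
    (h : Nondegenerate (W y)) (hW : ContDiffWithinAt ℝ ∞ W s y)
    (hφ : ContDiffWithinAt ℝ ∞ φ s y) :
    ContDiffWithinAt ℝ ∞ (fun z => (flatₗ (W z)).inverse (φ z)) s y := by
  have h1 : ContDiffWithinAt ℝ ∞ (fun z => (flatₗ (W z)).inverse) s y :=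
    (contDiffAt_inverse_flatₗ h).comp_contDiffWithinAt y hW
  exact h1.clm_apply hφ

theorem contDiffOn_lefschetzDual {W : E → E [⋀^Fin 2]→L[ℝ] ℝ} {l : ℕ}
    {η : E → E [⋀^Fin (l + 2)]→L[ℝ] ℝ} {σ : E → E [⋀^Fin l]→L[ℝ] ℝ} {s : Set E}
    (hW : ContDiffOn ℝ ∞ W s) (hη : ContDiffOn ℝ ∞ η s)
    (hσ : ∀ y ∈ s, ∃ h : Nondegenerate (W y), σ y = lefschetzDual (W y) h (η y)) :
    ContDiffOn ℝ ∞ σ s := by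
  have h1 : ContDiffOn ℝ ∞ (fun y => (2⁻¹ : ℝ) • ∑ a, interior (Module.finBasis ℝ E a)
      (interior ((flatₗ (W y)).inverse
        (LinearMap.toContinuousLinearMap ((Module.finBasis ℝ E).coord a))) (η y))) s := by
    intro y hy
    obtain ⟨h, -⟩ := hσ y hy
    refine ContDiffWithinAt.const_smul _ (ContDiffWithinAt.sum fun a _ => ?_)
    exact contDiffWithinAt_interior contDiffWithinAt_const (contDiffWithinAt_interior
      (contDiffWithinAt_sharp h (hW y hy) contDiffWithinAt_const) (hη y hy))
  refine h1.congr fun y hy => ?_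
  obtain ⟨h, hy2⟩ := hσ y hy
  rw [hy2, lefschetzDual_eq_sum]
  congr 1
  refine Finset.sum_congr rfl fun a _ => ?_
  obtain ⟨e, he, h3⟩ := sharp_eq_inverse h
  rw [← h3]
  rfl

omit [FiniteDimensional ℝ E] in
theorem contDiffOn_extDeriv {k : ℕ} {W : E → E [⋀^Fin k]→L[ℝ] ℝ} {s : Set E} (hs : IsOpen s)
    (hW : ContDiffOn ℝ ∞ W s) : ContDiffOn ℝ ∞ (extDeriv W) s := by
  have h1 : ContDiffOn ℝ ∞ (fderiv ℝ W) s := hW.fderiv_of_isOpen hs (by simp)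
  exact (ContinuousAlternatingMap.alternatizeUncurryFinCLM ℝ E ℝ).contDiff.comp_contDiffOn h1

/-- The product of a form with a `2`-form as a bilinear map. -/
def wedgeTwoₗ (k : ℕ) : (E [⋀^Fin k]→L[ℝ] ℝ) →ₗ[ℝ] (E [⋀^Fin 2]→L[ℝ] ℝ) →ₗ[ℝ]
    E [⋀^Fin (k + 2)]→L[ℝ] ℝ :=
  LinearMap.mk₂ ℝ wedge
    (fun μ ν τ => single_injective (by
      rw [single_add, single_wedge_two, single_wedge_two, single_wedge_two, single_add, map_add]))
    (fun c ν τ => single_injective (by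
      rw [single_smul, single_wedge_two, single_wedge_two, single_smul, map_smul]))
    (fun ν τ τ' => single_injective (by
      rw [single_add, single_wedge_two, single_wedge_two, single_wedge_two, lefschetz_add]; rfl))
    (fun c ν τ => single_injective (by
      rw [single_smul, single_wedge_two, single_wedge_two, lefschetz_smul]; rfl))

/-- In this form `d` is built from `ext`, with which `lefschetz` commutes. -/
theorem extDeriv_eq_sum {k : ℕ} (W : E → E [⋀^Fin k]→L[ℝ] ℝ) (y : E) :
    extDeriv W y = ∑ a, covectorWedge ((Module.finBasis ℝ E).coord a)
      (fderiv ℝ W y (Module.finBasis ℝ E a)) := by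
  rw [extDeriv]
  simp only [covectorWedge, ← ContinuousAlternatingMap.alternatizeUncurryFinCLM_apply]
  rw [← map_sum]
  congr 1
  ext v : 1
  simp only [sum_apply, ContinuousLinearMap.smulRight_apply,
    LinearMap.coe_toContinuousLinearMap', ← map_smul, ← map_sum]
  congr 1
  exact (sum_coord_smul _ v).symm

theorem differentiableAt_wedgePow {W : E → E [⋀^Fin 2]→L[ℝ] ℝ} {y : E}
    (hW : DifferentiableAt ℝ W y) (m : ℕ) :
    DifferentiableAt ℝ (fun z => wedgePow (W z) m) y := by
  induction m with
  | zero => exact differentiableAt_const _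
  | succ m ih =>
    exact ((LinearMap.toContinuousBilinearMap (wedgeTwoₗ (E := E) (2 * m))).hasFDerivAt_of_bilinear
      ih.hasFDerivAt hW.hasFDerivAt).differentiableAt

theorem fderiv_wedgePow_succ {W : E → E [⋀^Fin 2]→L[ℝ] ℝ} {y : E}
    (hW : DifferentiableAt ℝ W y) (m : ℕ) (v : E) :
    single (fderiv ℝ (fun z => wedgePow (W z) (m + 1)) y v)
      = lefschetz (fderiv ℝ W y v) (single (wedgePow (W y) m))
        + lefschetz (W y) (single (fderiv ℝ (fun z => wedgePow (W z) m) y v)) := by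
  have h1 := ((LinearMap.toContinuousBilinearMap
    (wedgeTwoₗ (E := E) (2 * m))).hasFDerivAt_of_bilinear
      (differentiableAt_wedgePow hW m).hasFDerivAt hW.hasFDerivAt).fderiv
  have h2 := congrArg (fun f => single (f v)) h1
  rw [← single_wedge_two, ← single_wedge_two, ← single_add]
  exact h2

theorem single_extDeriv_wedgePow {W : E → E [⋀^Fin 2]→L[ℝ] ℝ} {y : E}
    (hW : DifferentiableAt ℝ W y) (m : ℕ) :
    single (extDeriv (fun z => wedgePow (W z) (m + 1)) y)
      = ((m : ℝ) + 1) • (lefschetz (W y) ^ m) (single (extDeriv W y)) := by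
  -- Leibniz rule for `Ω^m ∧ Ω`; 2-forms commute with everything, so `Ω^m` can be moved in front of
  -- `dΩ` without sign.
  have key : ∀ m : ℕ, single (extDeriv (fun z => wedgePow (W z) (m + 1)) y)
      = (lefschetz (W y) ^ m) (single (extDeriv W y))
        + lefschetz (W y) (single (extDeriv (fun z => wedgePow (W z) m) y)) := by
    intro m
    rw [extDeriv_eq_sum, extDeriv_eq_sum, extDeriv_eq_sum, single_sum, single_sum, single_sum,
      map_sum, map_sum, ← Finset.sum_add_distrib]
    refine Finset.sum_congr rfl fun a _ => ?_
    simp only [← ext_single]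
    rw [fderiv_wedgePow_succ hW, map_add, lefschetz_ext]
    congr 1
    rw [single_wedgePow]
    have h1 : ∀ (j : ℕ) (α : Module.Dual ℝ E) (F : Forms E),
        (lefschetz (W y) ^ j) (ext α F) = ext α ((lefschetz (W y) ^ j) F) := by
      intro j α F
      induction j with
      | zero => rfl
      | succ j ih =>
        rw [pow_succ', Module.End.mul_apply, Module.End.mul_apply, ih, lefschetz_ext]
    have h2 : ∀ (j : ℕ) (τ : E [⋀^Fin 2]→L[ℝ] ℝ) (F : Forms E),
        (lefschetz (W y) ^ j) (lefschetz τ F) = lefschetz τ ((lefschetz (W y) ^ j) F) := by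
      intro j τ F
      induction j with
      | zero => rfl
      | succ j ih =>
        rw [pow_succ', Module.End.mul_apply, Module.End.mul_apply, ih, lefschetz_lefschetz]
    rw [h1, ← lefschetz_one, h2]
  induction m with
  | zero =>
    rw [key 0]
    have h3 : extDeriv (fun z => wedgePow (W z) 0) y = 0 := by
      rw [extDeriv_eq_sum]
      refine Finset.sum_eq_zero fun a _ => ?_
      have h4 : fderiv ℝ (fun z => wedgePow (W z) 0) y = 0 := fderiv_const_apply _
      rw [h4]
      exact covectorWedge_zero _
    rw [h3, single_zero, map_zero]
    simp
  | succ m ih =>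
    rw [key (m + 1), ih, map_smul, ← Module.End.mul_apply, ← pow_succ']
    push_cast
    module

/-- Evaluated on `(a, b)`, the derivatives of `η` along `a` and `b` cancel between `i(X)dη` and
`d(i(X)η)`; the derivatives of `X` give the rest. -/
theorem lieDerivVectorSpace_eq {X : E → E} {η : E → E [⋀^Fin 2]→L[ℝ] ℝ} {y : E}
    (hX : DifferentiableAt ℝ X y) (hη : DifferentiableAt ℝ η y) :
    lieDerivVectorSpace X η y
      = interior (X y) (extDeriv η y) + extDeriv (fun z => interior (X z) (η z)) y := by
  have h1 := ((LinearMap.toContinuousBilinearMap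
    (interiorₗ (E := E) 1)).hasFDerivAt_of_bilinear hX.hasFDerivAt hη.hasFDerivAt).fderiv
  have h2 : ∀ v w, fderiv ℝ (fun z => interior (X z) (η z)) y v (fun _ => w)
      = fderiv ℝ η y v ![X y, w] + η y ![fderiv ℝ X y v, w] := by
    intro v w
    have h3 := congrArg (fun f => f v (fun _ => w)) h1
    refine h3.trans ?_
    have h4 : (Matrix.vecCons (X y) fun _ : Fin 1 => w) = ![X y, w] := by
      ext i
      fin_cases i <;> rfl
    have h5 : (Matrix.vecCons (fderiv ℝ X y v) fun _ : Fin 1 => w) = ![fderiv ℝ X y v, w] := by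
      ext i
      fin_cases i <;> rfl
    rw [← h4, ← h5]
    rfl
  ext v
  obtain ⟨a, b, rfl⟩ : ∃ a b, v = ![a, b] := ⟨v 0, v 1, by ext i; fin_cases i <;> rfl⟩
  have h3 : ∀ (μ : E [⋀^Fin 2]→L[ℝ] ℝ) (c d : E), μ ![c, d] = -μ ![d, c] := fun μ c d => by
    rw [← flat_apply, ← flat_apply, flat_antisymm]
  have h4 : (η y).fderivCompContinuousLinearMap (ContinuousLinearMap.id ℝ E) (fderiv ℝ X y) ![a, b]
      = η y ![fderiv ℝ X y a, b] + η y ![a, fderiv ℝ X y b] := by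
    rw [ContinuousAlternatingMap.fderivCompContinuousLinearMap_apply, Fin.sum_univ_two]
    congr 2 <;>
    · ext i
      fin_cases i <;> simp
  have h5 : interior (X y) (extDeriv η y) ![a, b] = fderiv ℝ η y (X y) ![a, b]
      - fderiv ℝ η y a ![X y, b] + fderiv ℝ η y b ![X y, a] := by
    rw [interior_apply, extDeriv, ContinuousAlternatingMap.alternatizeUncurryFin_apply,
      Fin.sum_univ_three]
    have e0 : (0 : Fin 3).removeNth (Matrix.vecCons (X y) ![a, b]) = ![a, b] := by
      ext i
      fin_cases i <;> rfl
    have e1 : (1 : Fin 3).removeNth (Matrix.vecCons (X y) ![a, b]) = ![X y, b] := by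
      ext i
      fin_cases i <;> rfl
    have e2 : (2 : Fin 3).removeNth (Matrix.vecCons (X y) ![a, b]) = ![X y, a] := by
      ext i
      fin_cases i <;> rfl
    rw [e0, e1, e2]
    simp
    ring
  have h6 : extDeriv (fun z => interior (X z) (η z)) y ![a, b]
      = fderiv ℝ (fun z => interior (X z) (η z)) y a (fun _ => b)
        - fderiv ℝ (fun z => interior (X z) (η z)) y b (fun _ => a) := by
    rw [extDeriv, ContinuousAlternatingMap.alternatizeUncurryFin_apply, Fin.sum_univ_two]
    have e0 : (0 : Fin 2).removeNth ![a, b] = fun _ => b := by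
      ext i
      fin_cases i
      rfl
    have e1 : (1 : Fin 2).removeNth ![a, b] = fun _ => a := by
      ext i
      fin_cases i
      rfl
    rw [e0, e1]
    simp
    ring
  rw [lieDerivVectorSpace, ContinuousAlternatingMap.add_apply, ContinuousAlternatingMap.add_apply,
    h4, h5, h6, h2, h2, h3 (η y) a]
  ring

end Calculus

/-! ### Forms and vector fields in charts. -/

section Charts

variable {E : Type*} [NormedAddCommGroup E] [NormedSpace ℝ E]
variable {M : Type*} [TopologicalSpace M] [ChartedSpace E M]

variable (E) in
/-- The derivative of the inverse of the preferred chart at `x₀`. -/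
def chartInvDeriv (x₀ : M) (y : E) : E →L[ℝ] E :=
  mfderiv 𝓘(ℝ, E) 𝓘(ℝ, E) (extChartAt 𝓘(ℝ, E) x₀).symm y

variable (E) in
/-- The derivative of the preferred chart at `x₀`. -/
def chartDeriv (x₀ p : M) : E →L[ℝ] E :=
  mfderiv 𝓘(ℝ, E) 𝓘(ℝ, E) (extChartAt 𝓘(ℝ, E) x₀) p

/-- The value of a differential form, with the tangent space identified with the model space. -/
def DForm.value {k : ℕ} (ν : DForm E M k) (p : M) : E [⋀^Fin k]→L[ℝ] ℝ := ν p

/-- The value of a vector field, with the tangent space identified with the model space. -/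
def VField.value (X : VField E M) (p : M) : E := X p

theorem inChart_eq {k : ℕ} (ν : DForm E M k) (x₀ : M) (y : E) :
    ν.inChart x₀ y = (ν.value ((extChartAt 𝓘(ℝ, E) x₀).symm y)).compContinuousLinearMap
      (chartInvDeriv E x₀ y) := rfl

theorem inChart_vField_eq (X : VField E M) (x₀ : M) (y : E) :
    X.inChart x₀ y = chartDeriv E x₀ ((extChartAt 𝓘(ℝ, E) x₀).symm y)
      (X.value ((extChartAt 𝓘(ℝ, E) x₀).symm y)) := rfl

variable [IsManifold 𝓘(ℝ, E) ∞ M]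

/-- The tangent space at `x` is identified with `E` by the preferred chart at `x` itself. -/
theorem chartDeriv_self (x : M) : chartDeriv E x x = ContinuousLinearMap.id ℝ E :=
  mfderiv_extChartAt_self

theorem exists_chartEquiv (x₀ : M) {y : E} (hy : y ∈ (extChartAt 𝓘(ℝ, E) x₀).target) :
    ∃ A : E ≃L[ℝ] E, (A : E →L[ℝ] E) = chartInvDeriv E x₀ y ∧
      (A.symm : E →L[ℝ] E) = chartDeriv E x₀ ((extChartAt 𝓘(ℝ, E) x₀).symm y) := by
  have h1 := mfderiv_extChartAt_comp_mfderivWithin_extChartAt_symm (I := 𝓘(ℝ, E)) hy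
  have h2 := mfderivWithin_extChartAt_symm_comp_mfderiv_extChartAt (I := 𝓘(ℝ, E)) hy
  rw [ModelWithCorners.range_eq_univ, mfderivWithin_univ] at h1 h2
  exact ⟨ContinuousLinearEquiv.equivOfInverse (chartInvDeriv E x₀ y)
    (chartDeriv E x₀ ((extChartAt 𝓘(ℝ, E) x₀).symm y))
    (fun v => congrArg (fun f : E →L[ℝ] E => f v) h1)
    (fun v => congrArg (fun f : E →L[ℝ] E => f v) h2), rfl, rfl⟩

theorem chartInvDeriv_self (x : M) :
    chartInvDeriv E x (extChartAt 𝓘(ℝ, E) x x) = ContinuousLinearMap.id ℝ E := by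
  obtain ⟨A, hA, hA'⟩ := exists_chartEquiv (E := E) x (mem_extChartAt_target (I := 𝓘(ℝ, E)) x)
  rw [extChartAt_to_inv, chartDeriv_self] at hA'
  rw [← hA]
  ext v
  have h1 := congrArg (fun f : E →L[ℝ] E => A (f v)) hA'
  simpa using h1.symm

theorem ofChart_eq (x : M) {k : ℕ} (η : E → E [⋀^Fin k]→L[ℝ] ℝ) :
    ofChart x η = η (extChartAt 𝓘(ℝ, E) x x) := by
  change (η (extChartAt 𝓘(ℝ, E) x x)).compContinuousLinearMap (chartDeriv E x x) = _
  rw [chartDeriv_self]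
  rfl

theorem d_value {k : ℕ} (ν : DForm E M k) (x : M) :
    ν.d.value x = extDeriv (ν.inChart x) (extChartAt 𝓘(ℝ, E) x x) :=
  ofChart_eq x _

theorem inChart_self {k : ℕ} (ν : DForm E M k) (x : M) :
    ν.inChart x (extChartAt 𝓘(ℝ, E) x x) = ν.value x := by
  rw [inChart_eq, chartInvDeriv_self, extChartAt_to_inv]
  rfl

theorem inChart_vField_self (X : VField E M) (x : M) :
    X.inChart x (extChartAt 𝓘(ℝ, E) x x) = X.value x := by
  rw [inChart_vField_eq, extChartAt_to_inv, chartDeriv_self]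
  rfl

omit [IsManifold 𝓘(ℝ, E) ∞ M] in
theorem target_mem_nhds (x₀ : M) {y : E} (hy : y ∈ (extChartAt 𝓘(ℝ, E) x₀).target) :
    (extChartAt 𝓘(ℝ, E) x₀).target ∈ nhds y :=
  (isOpen_extChartAt_target x₀).mem_nhds hy

theorem mdifferentiableAt_chart_symm (x₀ : M) {y : E}
    (hy : y ∈ (extChartAt 𝓘(ℝ, E) x₀).target) :
    MDifferentiableAt 𝓘(ℝ, E) 𝓘(ℝ, E) (extChartAt 𝓘(ℝ, E) x₀).symm y :=
  (((contMDiffOn_extChartAt_symm (n := ∞) x₀).contMDiffAt (target_mem_nhds x₀ hy))).mdifferentiableAt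
    (by simp)

theorem interior_inChart {k : ℕ} (X : VField E M) (ν : DForm E M (k + 1)) (x₀ : M) {y : E}
    (hy : y ∈ (extChartAt 𝓘(ℝ, E) x₀).target) :
    (ν.interior X).inChart x₀ y = interior (X.inChart x₀ y) (ν.inChart x₀ y) := by
  obtain ⟨A, hA, hA'⟩ := exists_chartEquiv (E := E) x₀ hy
  rw [inChart_eq, inChart_eq, interior_pullback, inChart_vField_eq, ← hA, ← hA']
  have h1 : (A : E →L[ℝ] E) ((A.symm : E →L[ℝ] E)
      (X.value ((extChartAt 𝓘(ℝ, E) x₀).symm y))) = X.value ((extChartAt 𝓘(ℝ, E) x₀).symm y) :=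
    A.apply_symm_apply _
  rw [h1]
  rfl

theorem contDiffAt_transition (x₀ : M) {y : E} (hy : y ∈ (extChartAt 𝓘(ℝ, E) x₀).target) (x : M)
    (hx : (extChartAt 𝓘(ℝ, E) x₀).symm y ∈ (extChartAt 𝓘(ℝ, E) x).source) :
    ContDiffAt ℝ ∞ (extChartAt 𝓘(ℝ, E) x ∘ (extChartAt 𝓘(ℝ, E) x₀).symm) y := by
  rw [← contMDiffAt_iff_contDiffAt]
  refine ContMDiffAt.comp y (contMDiffAt_extChartAt' (by simpa using hx)) ?_
  exact (contMDiffOn_extChartAt_symm (n := ∞) x₀).contMDiffAt (target_mem_nhds x₀ hy)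

theorem transition_nhds (x₀ : M) {y : E} (hy : y ∈ (extChartAt 𝓘(ℝ, E) x₀).target) (x : M)
    (hx : (extChartAt 𝓘(ℝ, E) x₀).symm y ∈ (extChartAt 𝓘(ℝ, E) x).source) :
    ∀ᶠ z in nhds y, z ∈ (extChartAt 𝓘(ℝ, E) x₀).target ∧
      (extChartAt 𝓘(ℝ, E) x₀).symm z ∈ (extChartAt 𝓘(ℝ, E) x).source := by
  have h1 : ContinuousAt (extChartAt 𝓘(ℝ, E) x₀).symm y :=
    (mdifferentiableAt_chart_symm x₀ hy).continuousAt
  exact (Filter.eventually_of_mem (target_mem_nhds x₀ hy) fun _ h => h).and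
    (h1.eventually ((isOpen_extChartAt_source x).mem_nhds hx))

theorem chartInvDeriv_transition (x₀ : M) {y : E} (hy : y ∈ (extChartAt 𝓘(ℝ, E) x₀).target)
    (x : M) (hx : (extChartAt 𝓘(ℝ, E) x₀).symm y ∈ (extChartAt 𝓘(ℝ, E) x).source) :
    chartInvDeriv E x₀ y = (chartInvDeriv E x
        ((extChartAt 𝓘(ℝ, E) x ∘ (extChartAt 𝓘(ℝ, E) x₀).symm) y)).comp
      (fderiv ℝ (extChartAt 𝓘(ℝ, E) x ∘ (extChartAt 𝓘(ℝ, E) x₀).symm) y) := by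
  set f := extChartAt 𝓘(ℝ, E) x ∘ (extChartAt 𝓘(ℝ, E) x₀).symm
  have h1 : (extChartAt 𝓘(ℝ, E) x₀).symm =ᶠ[nhds y] (extChartAt 𝓘(ℝ, E) x).symm ∘ f := by
    filter_upwards [transition_nhds x₀ hy x hx] with z hz
    exact ((extChartAt 𝓘(ℝ, E) x).left_inv hz.2).symm
  have h2 := h1.mfderiv_eq (I := 𝓘(ℝ, E)) (I' := 𝓘(ℝ, E))
  have h3 : f y ∈ (extChartAt 𝓘(ℝ, E) x).target := (extChartAt 𝓘(ℝ, E) x).map_source hx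
  have h4 := mfderiv_comp (I := 𝓘(ℝ, E)) (I' := 𝓘(ℝ, E)) (I'' := 𝓘(ℝ, E)) y
    (mdifferentiableAt_chart_symm x h3)
    ((contDiffAt_transition x₀ hy x hx).contMDiffAt.mdifferentiableAt (by simp))
  have h5 : mfderiv 𝓘(ℝ, E) 𝓘(ℝ, E) f y = fderiv ℝ f y := mfderiv_eq_fderiv
  exact h2.trans (h4.trans (by rw [← h5]; rfl))

theorem inChart_transition {k : ℕ} (ν : DForm E M k) (x₀ : M) {y : E}
    (hy : y ∈ (extChartAt 𝓘(ℝ, E) x₀).target) (x : M)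
    (hx : (extChartAt 𝓘(ℝ, E) x₀).symm y ∈ (extChartAt 𝓘(ℝ, E) x).source) :
    ν.inChart x₀ y = (ν.inChart x
        ((extChartAt 𝓘(ℝ, E) x ∘ (extChartAt 𝓘(ℝ, E) x₀).symm) y)).compContinuousLinearMap
      (fderiv ℝ (extChartAt 𝓘(ℝ, E) x ∘ (extChartAt 𝓘(ℝ, E) x₀).symm) y) := by
  rw [inChart_eq, inChart_eq, chartInvDeriv_transition x₀ hy x hx]
  have h1 : (extChartAt 𝓘(ℝ, E) x).symm
      ((extChartAt 𝓘(ℝ, E) x ∘ (extChartAt 𝓘(ℝ, E) x₀).symm) y)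
      = (extChartAt 𝓘(ℝ, E) x₀).symm y := (extChartAt 𝓘(ℝ, E) x).left_inv hx
  rw [h1]
  rfl

/-- The exterior derivative does not depend on the chart. -/
theorem d_inChart {k : ℕ} {ν : DForm E M k} (hν : ν.IsSmooth) (x₀ : M) {y : E}
    (hy : y ∈ (extChartAt 𝓘(ℝ, E) x₀).target) :
    ν.d.inChart x₀ y = extDeriv (ν.inChart x₀) y := by
  -- `d` at a point is computed in the preferred chart of that very point, so the chart at `x₀` is
  -- compared with the chart at `x`, through the transition map `f`.
  set x := (extChartAt 𝓘(ℝ, E) x₀).symm y with hxdef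
  have hx : (extChartAt 𝓘(ℝ, E) x₀).symm y ∈ (extChartAt 𝓘(ℝ, E) x).source := by
    rw [← hxdef]
    exact mem_extChartAt_source x
  set f := extChartAt 𝓘(ℝ, E) x ∘ (extChartAt 𝓘(ℝ, E) x₀).symm with hf
  have h1 : ν.inChart x₀ =ᶠ[nhds y]
      fun z => (ν.inChart x (f z)).compContinuousLinearMap (fderiv ℝ f z) := by
    filter_upwards [transition_nhds x₀ hy x hx] with z hz
    exact inChart_transition ν x₀ hz.1 x hz.2
  have hfy : f y = extChartAt 𝓘(ℝ, E) x x := rfl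
  have h2 : DifferentiableAt ℝ (ν.inChart x) (f y) := by
    rw [hfy]
    exact ((hν x).contDiffAt (target_mem_nhds x (mem_extChartAt_target x))).differentiableAt
      (by simp)
  have h3 : minSmoothness ℝ 2 ≤ (∞ : WithTop ℕ∞) := by
    rw [minSmoothness_of_isRCLikeNormedField]
    exact WithTop.coe_le_coe.2 (le_top : (2 : ℕ∞) ≤ ⊤)
  rw [h1.extDeriv_eq, extDeriv_pullback h2 (contDiffAt_transition x₀ hy x hx) h3, inChart_eq,
    ← hxdef, d_value, ← hfy]
  congr 1
  rw [chartInvDeriv_transition x₀ hy x hx, ← hf, hfy, chartInvDeriv_self]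
  rfl

theorem isSmooth_d {k : ℕ} {ν : DForm E M k} (hν : ν.IsSmooth) : ν.d.IsSmooth := fun x₀ =>
  (contDiffOn_extDeriv (isOpen_extChartAt_target x₀) (hν x₀)).congr fun _ hy => d_inChart hν x₀ hy

theorem d_neg {k : ℕ} (ν : DForm E M k) : (-ν).d = -ν.d := by
  funext x
  change (-ν).d.value x = -ν.d.value x
  rw [d_value, d_value]
  -- As a scalar multiple, `-ν` can be differentiated without any smoothness of `ν`.
  have h1 : (-ν).inChart x = (-1 : ℝ) • ν.inChart x := by
    funext y
    rw [Pi.smul_apply, inChart_eq, inChart_eq]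
    ext v
    exact (neg_one_mul _).symm
  rw [h1, extDeriv_smul]
  ext v
  simp

theorem differential_inChart {f : M → ℝ} (hf : ContMDiff 𝓘(ℝ, E) 𝓘(ℝ, ℝ) ∞ f) (x₀ : M) {y : E}
    (hy : y ∈ (extChartAt 𝓘(ℝ, E) x₀).target) :
    (differential f : DForm E M 1).inChart x₀ y
      = oneForm (fderiv ℝ (f ∘ (extChartAt 𝓘(ℝ, E) x₀).symm) y) := by
  have h1 := mfderiv_comp (I := 𝓘(ℝ, E)) (I' := 𝓘(ℝ, E)) (I'' := 𝓘(ℝ, ℝ)) y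
    (hf.mdifferentiableAt (by simp) (x := (extChartAt 𝓘(ℝ, E) x₀).symm y))
    (mdifferentiableAt_chart_symm x₀ hy)
  rw [← mfderiv_eq_fderiv, h1]
  rfl

theorem contDiffOn_comp_chart_symm {f : M → ℝ} (hf : ContMDiff 𝓘(ℝ, E) 𝓘(ℝ, ℝ) ∞ f) (x₀ : M) :
    ContDiffOn ℝ ∞ (f ∘ (extChartAt 𝓘(ℝ, E) x₀).symm) (extChartAt 𝓘(ℝ, E) x₀).target := by
  rw [← contMDiffOn_iff_contDiffOn]
  exact hf.comp_contMDiffOn (contMDiffOn_extChartAt_symm x₀)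

/-- In a chart `df` is the exterior derivative of a 0-form, and `d² = 0`. -/
theorem d_differential {f : M → ℝ} (hf : ContMDiff 𝓘(ℝ, E) 𝓘(ℝ, ℝ) ∞ f) :
    (differential f : DForm E M 1).d = 0 := by
  funext x
  change (differential f : DForm E M 1).d.value x = 0
  rw [d_value]
  set y := extChartAt 𝓘(ℝ, E) x x
  have hy : y ∈ (extChartAt 𝓘(ℝ, E) x).target := mem_extChartAt_target x
  set g := f ∘ (extChartAt 𝓘(ℝ, E) x).symm
  have h1 : (differential f : DForm E M 1).inChart x =ᶠ[nhds y]
      extDeriv (fun z => ContinuousAlternatingMap.constOfIsEmpty ℝ E (Fin 0) (g z)) := by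
    filter_upwards [target_mem_nhds x hy] with z hz
    rw [differential_inChart hf x hz, extDeriv_constOfIsEmpty]
    rfl
  have h2 : ContDiffAt ℝ ∞
      (fun z => ContinuousAlternatingMap.constOfIsEmpty ℝ E (Fin 0) (g z)) y :=
    (ContinuousAlternatingMap.constOfIsEmptyLIE ℝ E ℝ (Fin 0)).toContinuousLinearEquiv.contDiff.contDiffAt.comp
      y ((contDiffOn_comp_chart_symm hf x).contDiffAt (target_mem_nhds x hy))
  have h3 : minSmoothness ℝ 2 ≤ (∞ : WithTop ℕ∞) := by
    rw [minSmoothness_of_isRCLikeNormedField]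
    exact WithTop.coe_le_coe.2 (le_top : (2 : ℕ∞) ≤ ⊤)
  rw [h1.extDeriv_eq, extDeriv_extDeriv_apply h2 h3]

/-- The trivialization of the tangent bundle at `x₀` is the derivative of the preferred chart. -/
theorem contMDiffAt_section_iff (X : VField E M) (x₀ : M) :
    ContMDiffAt 𝓘(ℝ, E) 𝓘(ℝ, E).tangent ∞
      (fun x : M => (⟨x, X x⟩ : TangentBundle 𝓘(ℝ, E) M)) x₀ ↔
    ContMDiffAt 𝓘(ℝ, E) 𝓘(ℝ, E) ∞ (fun p => chartDeriv E x₀ p (X.value p)) x₀ := by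
  have h1 := Bundle.contMDiffAt_section (n := ∞) (IB := 𝓘(ℝ, E)) (F := E)
    (E := (TangentSpace 𝓘(ℝ, E) : M → Type _)) (s := X) x₀
  refine h1.trans (Filter.EventuallyEq.contMDiffAt_iff ?_)
  filter_upwards [(chartAt E x₀).open_source.mem_nhds (mem_chart_source E x₀)] with p hp
  have h2 := TangentBundle.continuousLinearMapAt_trivializationAt (I := 𝓘(ℝ, E)) hp
  have h3 := congrArg (fun g : E →L[ℝ] E => g (X.value p)) h2
  refine Eq.trans ?_ h3
  exact (Bundle.Trivialization.continuousLinearMapAt_apply_of_mem ℝ _ (by simpa using hp) _).symm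

theorem isSmooth_vField_iff (X : VField E M) :
    X.IsSmooth ↔ ∀ x₀ : M, ContDiffAt ℝ ∞ (X.inChart x₀) (extChartAt 𝓘(ℝ, E) x₀ x₀) := by
  refine forall_congr' fun x₀ => (contMDiffAt_section_iff X x₀).trans ?_
  rw [← contMDiffAt_iff_contDiffAt]
  constructor
  · intro h
    have h1 : ContMDiffAt 𝓘(ℝ, E) 𝓘(ℝ, E) ∞ (extChartAt 𝓘(ℝ, E) x₀).symm
        (extChartAt 𝓘(ℝ, E) x₀ x₀) :=
      (contMDiffOn_extChartAt_symm x₀).contMDiffAt (target_mem_nhds x₀ (mem_extChartAt_target x₀))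
    exact ContMDiffAt.comp_of_eq h h1 (extChartAt_to_inv x₀)
  · intro h
    refine (h.comp x₀ contMDiffAt_extChartAt).congr_of_eventuallyEq ?_
    filter_upwards [(isOpen_extChartAt_source x₀).mem_nhds
      (mem_extChartAt_source (I := 𝓘(ℝ, E)) x₀)] with p hp
    rw [Function.comp_apply, inChart_vField_eq, (extChartAt 𝓘(ℝ, E) x₀).left_inv hp]

end Charts

/-! ### The form `σ`, the primitive remainder and Hamiltonian fields. -/

section LeeForm

variable {E : Type*} [NormedAddCommGroup E] [NormedSpace ℝ E] [FiniteDimensional ℝ E]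

theorem star_smul {Ω : E [⋀^Fin 2]→L[ℝ] ℝ} (h : Nondegenerate Ω) {n k l : ℕ}
    (hkl : 2 * n = l + k) (c : ℝ) (ν : E [⋀^Fin k]→L[ℝ] ℝ) :
    star Ω h hkl (c • ν) = c • star Ω h hkl ν := by
  rw [star_eq, star_eq, contractOp_smul, smul_comm]
  rfl

variable {M : Type*} [TopologicalSpace M] [ChartedSpace E M] [IsManifold 𝓘(ℝ, E) ∞ M]

theorem exists_nondegenerate_inChart (Ω : Form E M) (x₀ : M) {y : E}
    (hy : y ∈ (extChartAt 𝓘(ℝ, E) x₀).target) :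
    ∃ h : Nondegenerate (Ω.toDForm.inChart x₀ y),
      (∀ (l : ℕ) (ν : DForm E M (l + 2)), (Ω.lefschetzDual ν).inChart x₀ y
        = lefschetzDual (Ω.toDForm.inChart x₀ y) h (ν.inChart x₀ y)) ∧
      ∀ α : DForm E M 1, (Ω.sharp α).inChart x₀ y
        = sharp (Ω.toDForm.inChart x₀ y) h (covector (α.inChart x₀ y)) := by
  obtain ⟨A, hA, hA'⟩ := exists_chartEquiv (E := E) x₀ hy
  set p := (extChartAt 𝓘(ℝ, E) x₀).symm y with hp
  have h1 : ∀ (k : ℕ) (ν : DForm E M k),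
      ν.inChart x₀ y = (ν.value p).compContinuousLinearMap (A : E →L[ℝ] E) := fun k ν => by
    rw [inChart_eq, hA]
  have h2 : Nondegenerate (Ω.toDForm.value p) := Ω.nondegenerate p
  rw [h1]
  refine ⟨nondegenerate_pullback A h2, fun l ν => ?_, fun α => ?_⟩
  · rw [h1, h1, lefschetzDual_pullback A h2]
    rfl
  · rw [h1, inChart_vField_eq, ← hp, ← hA']
    have h3 := sharp_pullback A h2 (covector (α.value p))
    have h4 : (Ω.sharp α).value p = sharp _ h2 (covector (α.value p)) := rfl
    rw [h4, ← h3]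
    exact A.symm_apply_apply _

omit [FiniteDimensional ℝ E] [IsManifold 𝓘(ℝ, E) ∞ M] in
theorem differentiableAt_inChart {k : ℕ} {ν : DForm E M k} (hν : ν.IsSmooth) (x₀ : M) {y : E}
    (hy : y ∈ (extChartAt 𝓘(ℝ, E) x₀).target) : DifferentiableAt ℝ (ν.inChart x₀) y :=
  ((hν x₀).contDiffAt (target_mem_nhds x₀ hy)).differentiableAt (by simp)

/-- With `n = m + 2`: `d⋆Ω = (m+1) / (m+1)! · Ω^m ∧ dΩ`, and the second star supplies `m!`, so all
constants cancel. -/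
theorem codifferential_self {m : ℕ} (hE : Module.finrank ℝ E = 2 * (m + 2)) (Ω : Form E M)
    {l : ℕ} (hkl : 2 * (m + 2) = l + (1 + 1)) :
    Ω.codifferential hkl Ω.toDForm = Ω.lefschetzDual (l := 1) Ω.toDForm.d := by
  obtain rfl : l = 2 * (m + 1) := by omega
  funext x
  set y := extChartAt 𝓘(ℝ, E) x x
  have hx : Nondegenerate (Ω.toDForm.value x) := Ω.nondegenerate x
  set c : ℝ := ((m + 1).factorial : ℝ)⁻¹ with hc
  have h1 : ∀ p, (Ω.star hkl Ω.toDForm).value p = c • wedgePow (Ω.toDForm.value p) (m + 1) :=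
    fun p => star_self (V := E) (Ω.nondegenerate p) hE hkl
  have h2 : (Ω.star hkl Ω.toDForm).inChart x
      = c • fun z => wedgePow (Ω.toDForm.inChart x z) (m + 1) := by
    funext z
    rw [Pi.smul_apply, inChart_eq, inChart_eq, h1, wedgePow_pullback]
    rfl
  have h3 := congrFun (single_extDeriv_wedgePow (differentiableAt_inChart Ω.isSmooth x
    (mem_extChartAt_target x)) m) (2 * (m + 1) + 1)
  rw [single_same, Pi.smul_apply, inChart_self, ← d_value] at h3
  have h4 : (Ω.star hkl Ω.toDForm).d.value x = (c * ((m : ℝ) + 1)) •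
      (lefschetz (Ω.toDForm.value x) ^ m) (single (Ω.toDForm.d.value x)) (2 * m + 3) := by
    rw [d_value, h2, extDeriv_smul, h3, smul_smul]
    rfl
  have h5 := star_lefschetz_pow hx hE (by omega) (Ω.toDForm.d.value x)
  change star _ hx _ ((Ω.star hkl Ω.toDForm).d.value x) = lefschetzDual _ hx (Ω.toDForm.d.value x)
  rw [h4]
  refine (star_smul hx _ _ _).trans ?_
  refine (congrArg _ h5).trans ?_
  rw [smul_smul, hc, Nat.factorial_succ]
  have h6 : (m.factorial : ℝ) ≠ 0 := by positivity
  have h7 : (m : ℝ) + 1 ≠ 0 := by positivity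
  have h8 : ((((m + 1) * m.factorial : ℕ) : ℝ)⁻¹ * ((m : ℝ) + 1)) * (m.factorial : ℝ) = 1 := by
    push_cast
    field_simp
  rw [h8, one_smul]

theorem lee_eq {n : ℕ} (hn : 2 ≤ n) (hE : Module.finrank ℝ E = 2 * n) (Ω : Form E M) :
    Ω.lee hn = ((n : ℝ) - 1)⁻¹ • Ω.lefschetzDual (l := 1) Ω.toDForm.d := by
  obtain ⟨m, rfl⟩ := Nat.exists_eq_add_of_le' hn
  rw [Form.lee, codifferential_self hE]

theorem isSmooth_lefschetzDual (Ω : Form E M) {l : ℕ} {ν : DForm E M (l + 2)} (hν : ν.IsSmooth) :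
    (Ω.lefschetzDual ν).IsSmooth := fun x₀ =>
  contDiffOn_lefschetzDual (Ω.isSmooth x₀) (hν x₀) fun _ hy =>
    (exists_nondegenerate_inChart Ω x₀ hy).imp fun _ h => h.1 l ν

omit [FiniteDimensional ℝ E] [IsManifold 𝓘(ℝ, E) ∞ M] in
theorem isSmooth_smul {k : ℕ} (c : ℝ) {ν : DForm E M k} (hν : ν.IsSmooth) :
    (c • ν).IsSmooth := fun x₀ =>
  ((hν x₀).const_smul c).congr fun _ _ => rfl

omit [FiniteDimensional ℝ E] [IsManifold 𝓘(ℝ, E) ∞ M] in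
theorem isSmooth_sub {k : ℕ} {μ ν : DForm E M k} (hμ : μ.IsSmooth) (hν : ν.IsSmooth) :
    (μ - ν).IsSmooth := fun x₀ =>
  ((hμ x₀).sub (hν x₀)).congr fun _ _ => rfl

omit [IsManifold 𝓘(ℝ, E) ∞ M] in
theorem isSmooth_wedge_two {k : ℕ} {μ : DForm E M k} {ν : DForm E M 2} (hμ : μ.IsSmooth)
    (hν : ν.IsSmooth) : (μ.wedge ν).IsSmooth := fun x₀ => by
  have h1 := (LinearMap.toContinuousBilinearMap
    (wedgeTwoₗ (E := E) k)).isBoundedBilinearMap.contDiff (n := ∞)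
  refine (h1.comp_contDiffOn ((hμ x₀).prodMk (hν x₀))).congr fun y _ => ?_
  rw [inChart_eq]
  exact (wedge_pullback _ _ _).symm

theorem isSmooth_lee {n : ℕ} (hn : 2 ≤ n) (hE : Module.finrank ℝ E = 2 * n) (Ω : Form E M) :
    (Ω.lee hn).IsSmooth := by
  rw [lee_eq hn hE]
  exact isSmooth_smul _ (isSmooth_lefschetzDual Ω (isSmooth_d Ω.isSmooth))

omit [FiniteDimensional ℝ E] in
theorem wedge_neg_sub_interior_neg (α β : E [⋀^Fin 1]→L[ℝ] ℝ) (v : E)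
    (ψ : E [⋀^Fin 3]→L[ℝ] ℝ) :
    wedge α (-β) - interior (-v) ψ = -(wedge α β - interior v ψ) := by
  have h1 : wedge α (-β) = -wedge α β := by
    ext w
    change wedge α (-β) w = -(wedge α β w)
    rw [wedge_apply, wedge_apply]
    simp [altSum]
  have h2 : interior (-v) ψ = -interior v ψ := map_neg ψ.curryLeft v
  rw [h1, h2]
  abel

theorem lefschetzDual_sub {Ω : E [⋀^Fin 2]→L[ℝ] ℝ} (h : Nondegenerate Ω) {l : ℕ}
    (μ ν : E [⋀^Fin (l + 2)]→L[ℝ] ℝ) :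
    lefschetzDual Ω h (μ - ν) = lefschetzDual Ω h μ - lefschetzDual Ω h ν :=
  single_injective (by
    rw [single_sub, ← dualLefschetz_single, ← dualLefschetz_single, ← dualLefschetz_single,
      single_sub, map_sub])

/-- `Λ(σ ∧ Ω) = (n - 1)σ = ΛdΩ`. -/
theorem isPrimitive_remainder {n : ℕ} (hn : 2 ≤ n) (hE : Module.finrank ℝ E = 2 * n)
    (Ω : Form E M) :
    Ω.IsPrimitive (l := 1) (Ω.toDForm.d - (Ω.lee hn).wedge Ω.toDForm) := by
  funext x
  have hx : Nondegenerate (Ω.toDForm.value x) := Ω.nondegenerate x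
  have h1 : (Ω.lee hn).value x = ((n : ℝ) - 1)⁻¹ • lefschetzDual _ hx (Ω.toDForm.d.value x) :=
    congrFun (lee_eq hn hE Ω) x
  change lefschetzDual _ hx (l := 1)
    (Ω.toDForm.d.value x - wedge ((Ω.lee hn).value x) (Ω.toDForm.value x)) = 0
  have h2 : (n : ℝ) - 1 ≠ 0 := by
    have : (2 : ℝ) ≤ n := by exact_mod_cast hn
    linarith
  have h3 := lefschetzDual_sub hx (l := 1) (Ω.toDForm.d.value x)
    (wedge ((Ω.lee hn).value x) (Ω.toDForm.value x))
  rw [h3, lefschetzDual_wedge_one hx hE, h1, smul_inv_smul₀ h2, sub_self]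

/-- Cartan's formula for a `2`-form. -/
theorem lieDeriv_eq {X : VField E M} (hX : X.IsSmooth) {ν : DForm E M 2} (hν : ν.IsSmooth) :
    ν.lieDeriv X = ν.d.interior X + (ν.interior X).d := by
  funext x
  set y := extChartAt 𝓘(ℝ, E) x x
  have hy : y ∈ (extChartAt 𝓘(ℝ, E) x).target := mem_extChartAt_target x
  have h1 : (ν.interior X).inChart x =ᶠ[nhds y]
      fun z => interior (X.inChart x z) (ν.inChart x z) := by
    filter_upwards [target_mem_nhds x hy] with z hz using interior_inChart X ν x hz
  have h2 : (ν.lieDeriv X).value x = _ := ofChart_eq x (lieDerivVectorSpace _ _)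
  rw [lieDerivVectorSpace_eq (((isSmooth_vField_iff X).1 hX x).differentiableAt (by simp))
    (differentiableAt_inChart hν x hy), inChart_vField_self, ← d_value, ← h1.extDeriv_eq,
    ← d_value] at h2
  exact h2

theorem isSmooth_sharp (Ω : Form E M) {α : DForm E M 1} (hα : α.IsSmooth) :
    (Ω.sharp α).IsSmooth := by
  rw [isSmooth_vField_iff]
  intro x
  set y := extChartAt 𝓘(ℝ, E) x x
  have hy : y ∈ (extChartAt 𝓘(ℝ, E) x).target := mem_extChartAt_target x
  let c : (E [⋀^Fin 1]→L[ℝ] ℝ) →ₗ[ℝ] E →L[ℝ] ℝ :=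
    { toFun := fun β => (ContinuousAlternatingMap.ofSubsingleton ℝ E ℝ (0 : Fin 1)).symm β
      map_add' := fun _ _ => rfl
      map_smul' := fun _ _ => rfl }
  have h1 : ContDiffAt ℝ ∞ (fun z => LinearMap.toContinuousLinearMap c (α.inChart x z)) y :=
    (LinearMap.toContinuousLinearMap c).contDiff.contDiffAt.comp y
      ((hα x).contDiffAt (target_mem_nhds x hy))
  obtain ⟨h2, -⟩ := exists_nondegenerate_inChart Ω x hy
  have h3 := contDiffWithinAt_sharp h2
    ((Ω.isSmooth x).contDiffAt (target_mem_nhds x hy)).contDiffWithinAt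
    (contDiffWithinAt_univ.2 h1)
  refine (contDiffWithinAt_univ.1 h3).congr_of_eventuallyEq ?_
  filter_upwards [target_mem_nhds x hy] with z hz
  obtain ⟨h4, -, h5⟩ := exists_nondegenerate_inChart Ω x hz
  obtain ⟨e, -, h6⟩ := sharp_eq_inverse h4
  rw [h5, ← h6]
  rfl

theorem isSmooth_differential {f : M → ℝ} (hf : ContMDiff 𝓘(ℝ, E) 𝓘(ℝ, ℝ) ∞ f) :
    (differential f : DForm E M 1).IsSmooth := fun x₀ => by
  have h1 : ContDiffOn ℝ ∞ (fderiv ℝ (f ∘ (extChartAt 𝓘(ℝ, E) x₀).symm))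
      (extChartAt 𝓘(ℝ, E) x₀).target :=
    (contDiffOn_comp_chart_symm hf x₀).fderiv_of_isOpen (isOpen_extChartAt_target x₀) (by simp)
  let c : (E →L[ℝ] ℝ) →ₗ[ℝ] E [⋀^Fin 1]→L[ℝ] ℝ :=
    { toFun := oneForm
      map_add' := fun _ _ => rfl
      map_smul' := fun _ _ => rfl }
  exact ((LinearMap.toContinuousLinearMap c).contDiff.comp_contDiffOn h1).congr
    fun y hy => differential_inChart hf x₀ hy

omit [IsManifold 𝓘(ℝ, E) ∞ M] in
theorem interior_eq_iff_eq_sharp (Ω : Form E M) (X : VField E M) (α : DForm E M 1) :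
    Ω.toDForm.interior X = α ↔ X = Ω.sharp α := by
  have key : ∀ x, interior (X.value x) (Ω.toDForm.value x) = α.value x ↔
      X.value x = sharp _ (Ω.nondegenerate x) (covector (α.value x)) := fun x => by
    have h1 : interior (X.value x) (Ω.toDForm.value x) = α.value x ↔
        flat (Ω.toDForm.value x) (X.value x) = covector (α.value x) := by
      refine ⟨congrArg covector, fun h => ?_⟩
      rw [interior_two_form, h, ← oneForm_covector]
    rw [h1]
    refine ⟨fun h => ?_, fun h => ?_⟩
    · rw [← h]
      exact (sharp_flat _ _).symm
    · rw [h]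
      exact flat_sharp _ _
  exact ⟨fun h => funext fun x => (key x).1 (congrFun h x),
    fun h => funext fun x => (key x).2 (congrFun h x)⟩

omit [IsManifold 𝓘(ℝ, E) ∞ M] in
theorem interior_d_eq_zero_iff {n : ℕ} (hn : 2 ≤ n) (hE : Module.finrank ℝ E = 2 * n)
    (Ω : Form E M) {ψ : DForm E M 3} (hψ : Ω.toDForm.d = (Ω.lee hn).wedge Ω.toDForm + ψ)
    (hψ' : Ω.IsPrimitive (l := 1) ψ) (X : VField E M) :
    Ω.toDForm.d.interior X = 0 ↔ (Ω.lee hn).interior X = 0 ∧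
      (Ω.lee hn).wedge (Ω.toDForm.interior X) - ψ.interior X = 0 := by
  have h1 : ∀ x, Ω.toDForm.d.interior X x = 0 ↔ (Ω.lee hn).interior X x = 0 ∧
      ((Ω.lee hn).wedge (Ω.toDForm.interior X) - ψ.interior X) x = 0 := fun x =>
    interior_eq_zero_iff (V := E) (Ω.nondegenerate x) hn hE (X x) (Ω.lee hn x) (Ω.toDForm.d x)
      (ψ x) (congrFun hψ x) (congrFun hψ' x)
  exact ⟨fun h => ⟨funext fun x => ((h1 x).1 (congrFun h x)).1,
    funext fun x => ((h1 x).1 (congrFun h x)).2⟩,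
    fun h => funext fun x => (h1 x).2 ⟨congrFun h.1 x, congrFun h.2 x⟩⟩

/-- Non-degeneracy forces `X = ♯(-df)`, which is smooth; as `df` is closed, Cartan's formula reduces
`L_X Ω` to `i(X)dΩ`. -/
theorem isHamiltonianFunction_iff (Ω : Form E M) {f : M → ℝ}
    (hf : ContMDiff 𝓘(ℝ, E) 𝓘(ℝ, ℝ) ∞ f) :
    Ω.IsHamiltonianFunction f ↔ Ω.toDForm.d.interior (Ω.sharp (-differential f)) = 0 := by
  have h1 : (Ω.sharp (-differential f)).IsSmooth :=
    isSmooth_sharp Ω fun x₀ => ((isSmooth_differential hf x₀).neg).congr fun _ _ => rfl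
  have h2 : Ω.toDForm.interior (Ω.sharp (-differential f)) = -differential f :=
    (interior_eq_iff_eq_sharp Ω _ _).2 rfl
  have h3 : Ω.toDForm.lieDeriv (Ω.sharp (-differential f))
      = Ω.toDForm.d.interior (Ω.sharp (-differential f)) := by
    rw [lieDeriv_eq h1 Ω.isSmooth, h2, d_neg, d_differential hf, neg_zero, add_zero]
  rw [← h3]
  constructor
  · rintro ⟨X, -, hX, hXf⟩
    rwa [← (interior_eq_iff_eq_sharp Ω X _).1 hXf]
  · exact fun h => ⟨_, h1, h, h2⟩

omit [IsManifold 𝓘(ℝ, E) ∞ M] in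
theorem sharp_neg (Ω : Form E M) (α : DForm E M 1) : Ω.sharp (-α) = -Ω.sharp α :=
  
  funext fun x => map_neg (sharp (V := E) (Ω.toDForm x) (Ω.nondegenerate x))
    (covector (V := E) (α x))

-- Antisymmetry of `♯`: `df(♯α) = -α(♯df)`.
omit [IsManifold 𝓘(ℝ, E) ∞ M] in
theorem interior_sharp_eq_zero_iff (Ω : Form E M) (α : DForm E M 1) (f : M → ℝ) :
    α.interior (Ω.sharp (-differential f)) = 0 ↔
      ∀ x : M, mfderiv 𝓘(ℝ, E) 𝓘(ℝ, ℝ) f x (Ω.sharp α x) = 0 := by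
  have key : ∀ x, α.interior (Ω.sharp (-differential f)) x = 0 ↔
      mfderiv 𝓘(ℝ, E) 𝓘(ℝ, ℝ) f x (Ω.sharp α x) = 0 := fun x => by
    let φ : E →L[ℝ] ℝ := mfderiv 𝓘(ℝ, E) 𝓘(ℝ, ℝ) f x
    have hx : Nondegenerate (Ω.toDForm.value x) := Ω.nondegenerate x
    have h1 : φ (sharp _ hx (covector (α.value x))) = -covector (α.value x) (sharp _ hx φ) :=
      apply_sharp hx (φ : Module.Dual ℝ E) _
    have h2 : (Ω.sharp (-differential f)) x = -sharp _ hx φ :=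
      congrFun (sharp_neg Ω (differential f)) x
    have h3 : α.interior (Ω.sharp (-differential f)) x = 0 ↔
        covector (α.value x) (-sharp _ hx φ) = 0 := by
      rw [← interior_oneForm_eq_zero_iff, ← h2]
      rfl
    rw [h3, map_neg, ← h1]
    rfl
  exact ⟨fun h x => (key x).1 (congrFun h x), fun h => funext fun x => (key x).2 (h x)⟩

end LeeForm

end AlmostSymplectic

end


open AlmostSymplectic in
theorem proposition2p2 {n : ℕ} (hn : 2 ≤ n)
    {E : Type*} [NormedAddCommGroup E] [NormedSpace ℝ E] [FiniteDimensional ℝ E]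
    (hE : Module.finrank ℝ E = 2 * n)
    {M : Type*} [TopologicalSpace M] [ChartedSpace E M] [IsManifold 𝓘(ℝ, E) ∞ M]
    (Ω : AlmostSymplectic.Form E M) :
    (Ω.lee hn).IsSmooth ∧
    ∃ ψ : DForm E M 3, ψ.IsSmooth ∧
      Ω.toDForm.d = (Ω.lee hn).wedge Ω.toDForm + ψ ∧
      Ω.IsPrimitive ψ ∧
      (n = 2 → ψ = 0) ∧
      (∀ X : VField E M, X.IsSmooth →
        (Ω.IsLocallyHamiltonian X ↔
          (Ω.lee hn).interior X = 0 ∧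
          (Ω.lee hn).wedge (Ω.toDForm.interior X) - ψ.interior X = 0 ∧
          (Ω.toDForm.interior X).d = 0)) ∧
      (∀ f : M → ℝ, ContMDiff 𝓘(ℝ, E) 𝓘(ℝ, ℝ) ∞ f →
        (Ω.IsHamiltonianFunction f ↔
          (∀ x : M, mfderiv 𝓘(ℝ, E) 𝓘(ℝ, ℝ) f x (Ω.sharp (Ω.lee hn) x) = 0) ∧
          (Ω.lee hn).wedge (differential f) -
            ψ.interior (Ω.sharp (differential f)) = 0)) := by
  set ψ : DForm E M 3 := Ω.toDForm.d - (Ω.lee hn).wedge Ω.toDForm with hψ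
  have hσ : (Ω.lee hn).IsSmooth := isSmooth_lee hn hE Ω
  have hd : Ω.toDForm.d = (Ω.lee hn).wedge Ω.toDForm + ψ := (add_sub_cancel _ _).symm
  have hprim : Ω.IsPrimitive (l := 1) ψ := isPrimitive_remainder hn hE Ω
  refine ⟨hσ, ψ, isSmooth_sub (isSmooth_d Ω.isSmooth) (isSmooth_wedge_two hσ Ω.isSmooth), hd,
    hprim, ?_, fun X hX => ?_, fun f hf => ?_⟩
  · rintro rfl
    exact funext fun x => three_form_eq_zero (V := E) (Ω.nondegenerate x) hE (ψ x)
      (congrFun hprim x)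
  · rw [← and_assoc, ← interior_d_eq_zero_iff hn hE Ω hd hprim X]
    constructor
    · rintro ⟨-, h1, h2⟩
      rw [lieDeriv_eq hX Ω.isSmooth, h1, add_zero] at h2
      exact ⟨h2, h1⟩
    · rintro ⟨h1, h2⟩
      refine ⟨hX, h2, ?_⟩
      rw [lieDeriv_eq hX Ω.isSmooth, h1, h2, add_zero]
  · rw [isHamiltonianFunction_iff Ω hf, interior_d_eq_zero_iff hn hE Ω hd hprim,
      interior_sharp_eq_zero_iff, (interior_eq_iff_eq_sharp Ω _ _).2 rfl, sharp_neg]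
    -- Here `i(X)Ω = -df` and `X = -♯df`, so the second condition only changes by an overall sign.
    have h1 : (Ω.lee hn).wedge (-differential f) - ψ.interior (-Ω.sharp (differential f))
        = -((Ω.lee hn).wedge (differential f) - ψ.interior (Ω.sharp (differential f))) := by
      exact funext fun x => wedge_neg_sub_interior_neg (E := E) _ _ _ _
    rw [h1, neg_eq_zero]
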